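/- Let $d\ge 1$ and $\mathbb N=\{0,1,2,\dots\}$. For $k\in\mathbb N$ let $\phi_k(x)=\frac{(-1)^k}{\sqrt{2^k k!\sqrt\pi}}\,e^{x^2/2}\frac{d^k}{dx^k}\big(e^{-x^2}\big)$, $x\in\mathbb R$, be the Hermite functions, and for $\alpha\in\mathbb N^d$ put $\Phi_\alpha(x)=\prod_{j=1}^d\phi_{\alpha_j}(x_j)$, $x\in\mathbb R^d$, and $|\alpha|=\alpha_1+\dots+\alpha_d$. Let $\Theta:[0,+\infty)\to[0,+\infty)$ be continuous, let $$GS_\Theta=\Big\{f\in L^2(\mathbb R^d;\mathbb C):\ \|f\|_{GS_\Theta}:=\Big(\sum_{\alpha\in\mathbb N^d}e^{2\Theta(|\alpha|)}\,|\langle f,\Phi_\alpha\rangle_{L^2(\mathbb R^d)}|^2\Big)^{1/2}<+\infty\Big\},$$ and let $M_p=\sup_{t\ge 0}t^pe^{-\Theta(t)}$ for $p\in\mathbb N$. Assume (H1) $0<M_p<+\infty$ for all $p\in\mathbb N$; (H2) there exist constants $C_\Theta>0$ and $L_\Theta\ge 1$ such that $p^p\le C_\Theta L_\Theta^p M_p$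 for all $p\in\mathbb N$, with the convention $0^0=1$. Then $GS_\Theta$ is included in the Schwartz space $\mathscr S(\mathbb R^d)$ (every $f\in GS_\Theta$ coincides almost everywhere with a Schwartz function, with which it is identified below). Moreover, for every $0<s\le 1$ there exists a constant $D=D_{\Theta,d,s}\ge 1$ such that for all $f\in GS_\Theta$, all real $r\ge 0$ and all $\beta\in\mathbb N^d$, $$\|\langle x\rangle^r\,\partial_x^\beta f\|_{L^2(\mathbb R^d)}\le D^{\,1+r+|\beta|}\,\Big(M_{\left\lfloor\frac{r+1+|\beta|+(2-s)(d+1)}{2s}\right\rfloor+1}\Big)^s\,\|f\|_{GS_\Theta},$$ where $\langle x\rangle=(1+\|x\|^2)^{1/2}$ with $\|\cdot\|$ the Euclidean norm, and $\lfloor\cdot\rfloor$ is the floor function. -/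

import Mathlib

open MeasureTheory
open scoped NNReal ENNReal SchwartzMap

noncomputable section

namespace GelfandShilov

/-- The Euclidean space `ℝ^d`. -/
abbrev Rd (d : ℕ) : Type := EuclideanSpace ℝ (Fin d)

/-- The length `|α| = α₁ + ⋯ + α_d` of a multi-index. -/
def len {d : ℕ} (α : Fin d → ℕ) : ℕ := ∑ j, α j

/-- The `k`-th Hermite function
`φ_k(x) = (-1)^k (2^k k! √π)^{-1/2} e^{x²/2} (d/dx)^k e^{-x²}` on `ℝ`. -/
def hermiteFun (k : ℕ) (x : ℝ) : ℝ :=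
  (-1) ^ k / Real.sqrt (2 ^ k * (Nat.factorial k : ℝ) * Real.sqrt Real.pi) *
    Real.exp (x ^ 2 / 2) * iteratedDeriv k (fun y : ℝ => Real.exp (-y ^ 2)) x

/-- The Hermite function `Φ_α(x) = ∏ⱼ φ_{αⱼ}(xⱼ)` on `ℝ^d`. -/
def hermiteFunRd {d : ℕ} (α : Fin d → ℕ) (x : Rd d) : ℝ := ∏ j, hermiteFun (α j) (x j)

/-- The Hermite coefficient `⟨f, Φ_α⟩ = ∫ f Φ_α` of `f ∈ L²(ℝ^d)` (`Φ_α` is real-valued). -/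
def hermiteCoeff {d : ℕ} (f : Lp ℂ 2 (volume : Measure (Rd d))) (α : Fin d → ℕ) : ℂ :=
  ∫ x, f x * (hermiteFunRd α x : ℂ)

/-- The norm `‖(e^{Θ(|α|)} ⟨f, Φ_α⟩)_α‖_{ℓ²(ℕ^d)}`, with values in `[0, ∞]`. -/
def gsNorm {d : ℕ} (Θ : ℝ≥0 → ℝ≥0) (f : Lp ℂ 2 (volume : Measure (Rd d))) : ℝ≥0∞ :=
  (∑' α : Fin d → ℕ,
    ENNReal.ofReal (Real.exp (Θ (len α : ℝ≥0)) * ‖hermiteCoeff f α‖) ^ 2) ^ (1 / 2 : ℝ)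

/-- The symmetric weighted Gelfand-Shilov space `GS_Θ ⊆ L²(ℝ^d)`. -/
def GS (d : ℕ) (Θ : ℝ≥0 → ℝ≥0) : Set (Lp ℂ 2 (volume : Measure (Rd d))) :=
  {f | gsNorm Θ f < ∞}

/-- `M_p = sup_{t ≥ 0} t^p e^{-Θ(t)}`, with values in `[0, ∞]`. -/
def M (Θ : ℝ≥0 → ℝ≥0) (p : ℕ) : ℝ≥0∞ :=
  ⨆ t : ℝ≥0, ENNReal.ofReal ((t : ℝ) ^ p * Real.exp (-(Θ t : ℝ)))

/-- (H1): `0 < M_p < ∞` for all `p`. -/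
def H1 (Θ : ℝ≥0 → ℝ≥0) : Prop := ∀ p : ℕ, 0 < M Θ p ∧ M Θ p < ∞

/-- (H2): `p^p ≤ C L^p M_p` for all `p`, for some `C > 0` and `L ≥ 1` (with `0^0 = 1`). -/
def H2 (Θ : ℝ≥0 → ℝ≥0) : Prop :=
  ∃ C L : ℝ≥0, 0 < C ∧ 1 ≤ L ∧ ∀ p : ℕ, (p : ℝ≥0∞) ^ p ≤ C * (L : ℝ≥0∞) ^ p * M Θ p

/-- The partial derivative `∂_j g`. -/
def partialDeriv {d : ℕ} (j : Fin d) (g : Rd d → ℂ) (x : Rd d) : ℂ :=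
  fderiv ℝ g x (EuclideanSpace.single j 1)

/-- The iterated partial derivative `∂^β g = ∂_1^{β_1} ⋯ ∂_d^{β_d} g`. -/
def multiDeriv {d : ℕ} (β : Fin d → ℕ) (g : Rd d → ℂ) : Rd d → ℂ :=
  (List.finRange d).foldr (fun j h => (partialDeriv j)^[β j] h) g

/-- The Japanese bracket `⟨x⟩ = (1 + ‖x‖²)^{1/2}`. -/
def bracket {d : ℕ} (x : Rd d) : ℝ := Real.sqrt (1 + ‖x‖ ^ 2)

end GelfandShilov

end

noncomputable section

namespace GelfandShilov

/-! ### One-dimensional Hermite functions: ladder relations -/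

/-! Multiplication by `x_j` and `∂_j` are ladder operators: each sends `Φ_α` to a combination of two
Hermite functions of length at most `|α| + 1`, with coefficients at most `√((|α| + 1)/2)`. As `‖Φ_α‖
= 1` in `L²`, a word of at most `N` such operators applied to `Φ_α` has `L²` norm at most `√2^N (1 +
N + |α|)^{N/2}` (`seminormL2_ladder_word_le`). The weight `⟨x⟩^r` is dominated by the words `1` and
`x_j^k` with `k = ⌈r⌉`, so `⟨x⟩^r ∂^β f` is controlled by words of length at most `N = k + |β|`.

Applying these words termwise to `f = ∑ ⟨f, Φ_α⟩ Φ_α`, and using Cauchy-Schwarz with the summable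
weight `(1 + |α|)^{-(d+1)}` (`sum_hermiteCoeff_le`), reduces the estimate to bounding `(1 + N +
t)^{(N+d+1)/2} e^{-Θ(t)}` over `t ≥ 0`. Since `Θ ≥ 0` and `s ≤ 1`, this is at most `((1 + N + t)^p
e^{-Θ(t)})^s` once `(N + d + 1)/2 ≤ s p`. The powers of `t` give `M_p`; the powers of `1 + N ≤ 2p`
give `p^p`, which (H2) bounds by `M_p` up to a geometric factor (`weight_mul_exp_le`).

The termwise argument needs the expansion to converge in the Schwartz space and to equal `f`. Every
Schwartz seminorm of `Φ_α` grows polynomially in `|α|`, by a sup bound on `φ_k` and the ladder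
relations, while (H1) makes the coefficients decay faster than any power. The sum has the same
Hermite coefficients as `f`, and the Hermite functions are total in `L²`
(`ae_eq_zero_of_integral_hermiteFunRd_eq_zero`). -/

theorem contDiff_gaussian : ContDiff ℝ (⊤ : ℕ∞) (fun y : ℝ => Real.exp (-y ^ 2)) := by
  fun_prop

theorem hasDerivAt_iteratedDeriv_gaussian (k : ℕ) (x : ℝ) :
    HasDerivAt (iteratedDeriv k (fun y : ℝ => Real.exp (-y ^ 2)))
      (iteratedDeriv (k + 1) (fun y : ℝ => Real.exp (-y ^ 2)) x) x := by
  rw [iteratedDeriv_succ]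
  refine ((ContDiff.differentiable_iteratedDeriv k contDiff_gaussian ?_) x).hasDerivAt
  exact WithTop.coe_lt_coe.2 (ENat.natCast_lt_top k)

/-- Differentiating the relation at `k` gives the one at `k + 1`. For `k = 0` the coefficient `2 *
k` cancels the term with the truncated index `k - 1`; the same convention serves in all later ladder
relations. -/
theorem iteratedDeriv_gaussian_succ (k : ℕ) (x : ℝ) :
    iteratedDeriv (k + 1) (fun y : ℝ => Real.exp (-y ^ 2)) x =
      -2 * x * iteratedDeriv k (fun y : ℝ => Real.exp (-y ^ 2)) x -
        2 * k * iteratedDeriv (k - 1) (fun y : ℝ => Real.exp (-y ^ 2)) x := by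
  induction k generalizing x with
  | zero =>
    have h : HasDerivAt (fun y : ℝ => Real.exp (-y ^ 2)) (Real.exp (-x ^ 2) * (-(2 * x))) x := by
      simpa using ((hasDerivAt_pow 2 x).neg).exp
    simp [iteratedDeriv_one, h.deriv]
    ring
  | succ k ih =>
    have h1 := hasDerivAt_iteratedDeriv_gaussian (k + 1) x
    have h2 : HasDerivAt (fun x : ℝ => -2 * x * iteratedDeriv k (fun y : ℝ => Real.exp (-y ^ 2)) x -
        2 * k * iteratedDeriv (k - 1) (fun y : ℝ => Real.exp (-y ^ 2)) x)
        (-2 * iteratedDeriv k (fun y : ℝ => Real.exp (-y ^ 2)) x +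
          -2 * x * iteratedDeriv (k + 1) (fun y : ℝ => Real.exp (-y ^ 2)) x -
          2 * k * iteratedDeriv k (fun y : ℝ => Real.exp (-y ^ 2)) x) x := by
      have ha := ((hasDerivAt_id x).const_mul (-2)).mul (hasDerivAt_iteratedDeriv_gaussian k x)
      have hb := (hasDerivAt_iteratedDeriv_gaussian (k - 1) x).const_mul (2 * (k : ℝ))
      have hk : 2 * (k : ℝ) * iteratedDeriv (k - 1 + 1) (fun y : ℝ => Real.exp (-y ^ 2)) x =
          2 * k * iteratedDeriv k (fun y : ℝ => Real.exp (-y ^ 2)) x := by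
        rcases k with _ | k <;> simp
      rw [hk] at hb
      refine (ha.sub hb).congr_deriv ?_
      simp only [mul_one, id]
    have h3 := h1.unique (h2.congr_of_eventuallyEq (Filter.Eventually.of_forall ih))
    rw [h3]
    rw [Nat.add_sub_cancel]
    push_cast
    ring

/-- The normalization constant of the `k`-th Hermite function. -/
def hermiteConst (k : ℕ) : ℝ :=
  (-1) ^ k / Real.sqrt (2 ^ k * (Nat.factorial k : ℝ) * Real.sqrt Real.pi)

theorem hermiteConst_succ (k : ℕ) :
    Real.sqrt (2 * (k + 1)) * hermiteConst (k + 1) = -hermiteConst k := by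
  have h : (2 : ℝ) ^ (k + 1) * (Nat.factorial (k + 1) : ℝ) * Real.sqrt Real.pi =
      (2 * (k + 1)) * (2 ^ k * (Nat.factorial k : ℝ) * Real.sqrt Real.pi) := by
    rw [Nat.factorial_succ]; push_cast; ring
  rw [hermiteConst, hermiteConst, h,
    Real.sqrt_mul (x := 2 * ((k : ℝ) + 1)) (by positivity)]
  have h1 : Real.sqrt (2 * ((k : ℝ) + 1)) ≠ 0 := by positivity
  generalize Real.sqrt (2 * ((k : ℝ) + 1)) = a at h1 ⊢
  rw [pow_succ]
  field_simp

theorem hermiteFun_eq (k : ℕ) (x : ℝ) : hermiteFun k x =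
    hermiteConst k * Real.exp (x ^ 2 / 2) * iteratedDeriv k (fun y : ℝ => Real.exp (-y ^ 2)) x :=
  rfl

theorem hasDerivAt_hermiteFun_creation (k : ℕ) (x : ℝ) :
    HasDerivAt (hermiteFun k)
      (x * hermiteFun k x - Real.sqrt (2 * (k + 1)) * hermiteFun (k + 1) x) x := by
  have h1 : HasDerivAt (fun x : ℝ => Real.exp (x ^ 2 / 2)) (Real.exp (x ^ 2 / 2) * x) x := by
    simpa using (((hasDerivAt_pow 2 x).div_const 2)).exp
  have h2 := (h1.const_mul (hermiteConst k)).mul (hasDerivAt_iteratedDeriv_gaussian k x)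
  have h3 : x * hermiteFun k x - Real.sqrt (2 * (k + 1)) * hermiteFun (k + 1) x =
      hermiteConst k * (Real.exp (x ^ 2 / 2) * x) *
        iteratedDeriv k (fun y : ℝ => Real.exp (-y ^ 2)) x +
      hermiteConst k * Real.exp (x ^ 2 / 2) *
        iteratedDeriv (k + 1) (fun y : ℝ => Real.exp (-y ^ 2)) x := by
    rw [hermiteFun_eq, hermiteFun_eq]
    linear_combination (-Real.exp (x ^ 2 / 2) *
      iteratedDeriv (k + 1) (fun y : ℝ => Real.exp (-y ^ 2)) x) * hermiteConst_succ k
  rw [h3]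
  exact h2

theorem sqrt_mul_hermiteConst_pred (k : ℕ) :
    Real.sqrt (2 * k) * hermiteConst (k - 1) = -(2 * k) * hermiteConst k := by
  rcases k with _ | k
  · simp
  · have h := hermiteConst_succ k
    have h2 : Real.sqrt (2 * ((k : ℝ) + 1)) * Real.sqrt (2 * ((k : ℝ) + 1)) = 2 * (k + 1) :=
      Real.mul_self_sqrt (by positivity)
    rw [Nat.add_sub_cancel]
    push_cast
    linear_combination Real.sqrt (2 * ((k : ℝ) + 1)) * h - hermiteConst (k + 1) * h2

theorem hermiteFun_three_term (k : ℕ) (x : ℝ) :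
    Real.sqrt (2 * (k + 1)) * hermiteFun (k + 1) x =
      2 * x * hermiteFun k x - Real.sqrt (2 * k) * hermiteFun (k - 1) x := by
  simp only [hermiteFun_eq, ← mul_assoc]
  rw [hermiteConst_succ, sqrt_mul_hermiteConst_pred, iteratedDeriv_gaussian_succ]
  ring

theorem sqrt_two_mul (a : ℝ) : Real.sqrt (2 * a) = 2 * Real.sqrt (a / 2) := by
  rw [show 2 * a = 2 ^ 2 * (a / 2) by ring, Real.sqrt_mul (by positivity),
    Real.sqrt_sq (by norm_num)]

theorem mul_hermiteFun (k : ℕ) (x : ℝ) :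
    x * hermiteFun k x = Real.sqrt (k / 2) * hermiteFun (k - 1) x +
      Real.sqrt ((k + 1) / 2) * hermiteFun (k + 1) x := by
  have h := hermiteFun_three_term k x
  rw [sqrt_two_mul, sqrt_two_mul] at h
  linarith

theorem hasDerivAt_hermiteFun (k : ℕ) (x : ℝ) :
    HasDerivAt (hermiteFun k) (Real.sqrt (k / 2) * hermiteFun (k - 1) x -
      Real.sqrt ((k + 1) / 2) * hermiteFun (k + 1) x) x := by
  have h := hasDerivAt_hermiteFun_creation k x
  rw [mul_hermiteFun, sqrt_two_mul] at h
  convert h using 1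
  ring

theorem hermiteFun_zero (x : ℝ) :
    hermiteFun 0 x = (Real.sqrt (Real.sqrt Real.pi))⁻¹ * Real.exp (-x ^ 2 / 2) := by
  have : Real.exp (-x ^ 2 / 2) = Real.exp (x ^ 2 / 2) * Real.exp (-x ^ 2) := by
    rw [← Real.exp_add]; ring_nf
  rw [hermiteFun_eq, this]
  simp [hermiteConst]
  ring

/-! ### The Gaussian as a Schwartz function -/

section Gaussian

variable {E : Type*} [NormedAddCommGroup E] [InnerProductSpace ℝ E]

theorem contDiff_neg_half_norm_sq {n : ℕ∞} : ContDiff ℝ n (fun y : E => -(‖y‖ ^ 2 / 2)) :=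
  ((contDiff_norm_sq ℝ).div_const 2).neg

/-- The first derivative is linear in `x`, the second constant and the others zero. The common form
`(1 + ‖x‖) ^ i` is the one that the Faà di Bruno bound in `decay_gaussian` takes as input. -/
theorem norm_iteratedFDeriv_neg_half_norm_sq_le (x : E) {i : ℕ} (hi : 1 ≤ i) :
    ‖iteratedFDeriv ℝ i (fun y : E => -(‖y‖ ^ 2 / 2)) x‖ ≤ (1 + ‖x‖) ^ i := by
  have hf : fderiv ℝ (fun y : E => -(‖y‖ ^ 2 / 2)) = ⇑(-innerSL ℝ : E →L[ℝ] E →L[ℝ] ℝ) := by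
    ext1 y
    have h := (hasStrictFDerivAt_norm_sq y).hasFDerivAt.mul_const (-1 / 2 : ℝ)
    refine HasFDerivAt.fderiv
      ((h.congr_of_eventuallyEq (Filter.Eventually.of_forall fun z => ?_)).congr_fderiv ?_)
    · simp only; ring
    · ext z; simp; ring
  obtain ⟨i, rfl⟩ : ∃ n, i = n + 1 := ⟨i - 1, by omega⟩
  rw [← norm_iteratedFDeriv_fderiv, hf]
  have h1 : (1 : ℝ) ≤ 1 + ‖x‖ := by linarith [norm_nonneg x]
  rcases i with _ | i
  · simp [innerSL_apply_norm]
  · rw [← norm_iteratedFDeriv_fderiv]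
    have h2 : fderiv ℝ ⇑(-innerSL ℝ : E →L[ℝ] E →L[ℝ] ℝ) = fun _ => -innerSL ℝ := by
      ext1 y; exact ContinuousLinearMap.fderiv _
    rw [h2]
    rcases i with _ | i
    · rw [norm_iteratedFDeriv_zero, norm_neg]
      exact (norm_innerSL_le ℝ).trans (one_le_pow₀ h1)
    · rw [iteratedFDeriv_const_of_ne (by omega)]
      simp only [Pi.zero_apply, norm_zero]
      positivity

theorem decay_gaussian (k n : ℕ) : ∃ C : ℝ, ∀ x : E,
    ‖x‖ ^ k * ‖iteratedFDeriv ℝ n (fun y : E => Real.exp (-(‖y‖ ^ 2 / 2))) x‖ ≤ C := by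
  refine ⟨n.factorial * ((k + n).factorial * Real.exp 2), fun x => ?_⟩
  have h := norm_iteratedFDeriv_comp_le (𝕜 := ℝ) (n := n) (N := (⊤ : ℕ∞)) Real.contDiff_exp
    (contDiff_neg_half_norm_sq (E := E)) (by exact_mod_cast le_top) x
    (C := Real.exp (-(‖x‖ ^ 2 / 2))) (D := 1 + ‖x‖)
    (fun i _ => by
      rw [norm_iteratedFDeriv_eq_norm_iteratedDeriv, iteratedDeriv_eq_iterate,
        Real.iter_deriv_exp, Real.norm_eq_abs, Real.abs_exp])
    (fun i hi _ => norm_iteratedFDeriv_neg_half_norm_sq_le x hi)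
  have hx := norm_nonneg x
  have h3 : (1 + ‖x‖) ^ (k + n) ≤ (k + n).factorial * Real.exp (1 + ‖x‖) := by
    have := Real.pow_div_factorial_le_exp (1 + ‖x‖) (by positivity) (k + n)
    rwa [div_le_iff₀ (by positivity), mul_comm] at this
  -- With `t = ‖x‖`, `1 + t - t²/2 = 3/2 - (t - 1)²/2 ≤ 2`.
  have h4 : Real.exp (1 + ‖x‖) * Real.exp (-(‖x‖ ^ 2 / 2)) ≤ Real.exp 2 := by
    rw [← Real.exp_add]
    apply Real.exp_le_exp.2
    nlinarith [sq_nonneg (‖x‖ - 1)]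
  calc ‖x‖ ^ k * ‖iteratedFDeriv ℝ n (fun y : E => Real.exp (-(‖y‖ ^ 2 / 2))) x‖
      ≤ (1 + ‖x‖) ^ k * (n.factorial * Real.exp (-(‖x‖ ^ 2 / 2)) * (1 + ‖x‖) ^ n) := by
        gcongr
        · linarith
        · exact h
    _ = n.factorial * ((1 + ‖x‖) ^ (k + n) * Real.exp (-(‖x‖ ^ 2 / 2))) := by
        rw [pow_add]; ring
    _ ≤ n.factorial * ((k + n).factorial * Real.exp (1 + ‖x‖) * Real.exp (-(‖x‖ ^ 2 / 2))) := by
        gcongr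
    _ ≤ _ := by
        rw [mul_assoc ((k + n).factorial : ℝ)]
        gcongr

/-- The Gaussian `exp (-‖x‖² / 2)` as a Schwartz function. -/
def gaussianSchwartz (E : Type*) [NormedAddCommGroup E] [InnerProductSpace ℝ E] : 𝓢(E, ℝ) where
  toFun x := Real.exp (-(‖x‖ ^ 2 / 2))
  smooth' := contDiff_neg_half_norm_sq.exp
  decay' := decay_gaussian

theorem gaussianSchwartz_apply (x : E) : gaussianSchwartz E x = Real.exp (-(‖x‖ ^ 2 / 2)) := rfl

end Gaussian

/-! ### Orthonormality and sup bounds in dimension one -/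

/-- The creation operator `x - d/dx` preserves the Schwartz space and maps `φ_k` to `√(2(k+1))
φ_{k+1}`, so everything comes from the Gaussian. -/
theorem exists_schwartz_eq_hermiteFun (k : ℕ) :
    ∃ u : 𝓢(ℝ, ℝ), ∀ x, u x = hermiteFun k x := by
  induction k with
  | zero =>
    refine ⟨(Real.sqrt (Real.sqrt Real.pi))⁻¹ • gaussianSchwartz ℝ, fun x => ?_⟩
    rw [smul_apply, gaussianSchwartz_apply, hermiteFun_zero]
    simp [neg_div]
  | succ k ih =>
    obtain ⟨u, hu⟩ := ih
    have hu' : (u : ℝ → ℝ) = hermiteFun k := funext hu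
    refine ⟨(Real.sqrt (2 * (k + 1)))⁻¹ • (SchwartzMap.smulLeftCLM ℝ (fun x : ℝ => x) u -
      SchwartzMap.derivCLM ℝ ℝ u), fun x => ?_⟩
    have h0 : Real.sqrt (2 * ((k : ℝ) + 1)) ≠ 0 := by positivity
    have hx : Function.HasTemperateGrowth (fun x : ℝ => x) :=
      (ContinuousLinearMap.id ℝ ℝ).hasTemperateGrowth
    rw [smul_apply, sub_apply, SchwartzMap.smulLeftCLM_apply_apply hx,
      SchwartzMap.derivCLM_apply, hu', (hasDerivAt_hermiteFun_creation k x).deriv]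
    simp only [smul_eq_mul]
    field_simp
    ring

/-- The `k`-th Hermite function as a Schwartz function on `ℝ`. -/
def hermiteSchwartzReal (k : ℕ) : 𝓢(ℝ, ℝ) := (exists_schwartz_eq_hermiteFun k).choose

theorem coe_hermiteSchwartzReal (k : ℕ) : (hermiteSchwartzReal k : ℝ → ℝ) = hermiteFun k :=
  funext (exists_schwartz_eq_hermiteFun k).choose_spec

theorem integrable_hermiteFun_mul (k l : ℕ) :
    Integrable (fun x => hermiteFun k x * hermiteFun l x) := by
  have := (SchwartzMap.pairing (ContinuousLinearMap.mul ℝ ℝ) (hermiteSchwartzReal k)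
    (hermiteSchwartzReal l)).integrable (μ := volume)
  refine this.congr (Filter.Eventually.of_forall fun x => ?_)
  simp [SchwartzMap.pairing_apply_apply, coe_hermiteSchwartzReal]

theorem integral_hermiteFun_zero_sq : ∫ x, hermiteFun 0 x * hermiteFun 0 x = 1 := by
  have h (x : ℝ) : hermiteFun 0 x * hermiteFun 0 x =
      (Real.sqrt Real.pi)⁻¹ * Real.exp (-1 * x ^ 2) := by
    rw [hermiteFun_zero, mul_mul_mul_comm, ← mul_inv, Real.mul_self_sqrt (by positivity),
      ← Real.exp_add]
    ring_nf
  simp_rw [h]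
  rw [integral_const_mul, integral_gaussian, div_one, inv_mul_cancel₀ (by positivity)]

/-- Adjointness of the creation and annihilation operators on Hermite functions. -/
theorem sqrt_mul_integral_hermiteFun_succ (k l : ℕ) :
    Real.sqrt (k + 1) * ∫ x, hermiteFun (k + 1) x * hermiteFun l x =
      Real.sqrt l * ∫ x, hermiteFun k x * hermiteFun (l - 1) x := by
  have hI := SchwartzMap.integral_mul_deriv_eq_neg_deriv_mul (hermiteSchwartzReal k)
    (hermiteSchwartzReal l)
  rw [coe_hermiteSchwartzReal, coe_hermiteSchwartzReal] at hI
  -- The left side is `(φ_k φ_l)'`, of integral zero. Writing `φ_l'` with the annihilation operator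
  -- and `φ_k'` with the creation operator cancels the terms `x φ_k φ_l`.
  have hx (x : ℝ) : hermiteFun k x * deriv (hermiteFun l) x + deriv (hermiteFun k) x *
      hermiteFun l x = 2 * Real.sqrt (l / 2) * (hermiteFun k x * hermiteFun (l - 1) x) -
        2 * Real.sqrt ((k + 1) / 2) * (hermiteFun (k + 1) x * hermiteFun l x) := by
    have h1 := mul_hermiteFun l x
    have h2 := mul_hermiteFun k x
    rw [(hasDerivAt_hermiteFun k x).deriv, (hasDerivAt_hermiteFun l x).deriv]
    linear_combination hermiteFun k x * h1 - hermiteFun l x * h2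
  have hi1 : Integrable fun x => hermiteFun k x * deriv (hermiteFun l) x := by
    have := (SchwartzMap.pairing (ContinuousLinearMap.mul ℝ ℝ) (hermiteSchwartzReal k)
      (SchwartzMap.derivCLM ℝ ℝ (hermiteSchwartzReal l))).integrable (μ := volume)
    refine this.congr (Filter.Eventually.of_forall fun x => ?_)
    simp [SchwartzMap.pairing_apply_apply, coe_hermiteSchwartzReal]
  have hi2 : Integrable fun x => deriv (hermiteFun k) x * hermiteFun l x := by
    have := (SchwartzMap.pairing (ContinuousLinearMap.mul ℝ ℝ)
      (SchwartzMap.derivCLM ℝ ℝ (hermiteSchwartzReal k)) (hermiteSchwartzReal l)).integrable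
      (μ := volume)
    refine this.congr (Filter.Eventually.of_forall fun x => ?_)
    simp [SchwartzMap.pairing_apply_apply, coe_hermiteSchwartzReal]
  have h0 : ∫ x, (hermiteFun k x * deriv (hermiteFun l) x + deriv (hermiteFun k) x *
      hermiteFun l x) = 0 := by
    rw [integral_add hi1 hi2, hI]; ring
  simp_rw [hx] at h0
  rw [integral_sub ((integrable_hermiteFun_mul _ _).const_mul _)
    ((integrable_hermiteFun_mul _ _).const_mul _), integral_const_mul, integral_const_mul,
    Real.sqrt_div (by positivity), Real.sqrt_div (by positivity)] at h0
  have h2 : Real.sqrt 2 ≠ 0 := by positivity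
  field_simp at h0
  linarith

/-- Adjointness lowers both indices together, until `∫ φ_0²` is reached or a factor `√0` appears. -/
theorem integral_hermiteFun_mul (k l : ℕ) :
    ∫ x, hermiteFun k x * hermiteFun l x = if k = l then 1 else 0 := by
  induction k generalizing l with
  | zero =>
    rcases l with _ | l
    · simpa using integral_hermiteFun_zero_sq
    · have h := sqrt_mul_integral_hermiteFun_succ l 0
      have h1 : Real.sqrt ((l : ℝ) + 1) ≠ 0 := by positivity
      simp only [Nat.cast_zero, Real.sqrt_zero, zero_mul, mul_eq_zero, h1, false_or] at h
      simp_rw [mul_comm (hermiteFun 0 _)]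
      simpa using h
  | succ k ih =>
    have h := sqrt_mul_integral_hermiteFun_succ k l
    have h1 : Real.sqrt ((k : ℝ) + 1) ≠ 0 := by positivity
    rcases l with _ | l
    · simpa [h1] using h
    · rw [Nat.add_sub_cancel, ih] at h
      by_cases hkl : k = l
      · subst hkl
        simpa [h1] using h
      · simpa [h1, hkl] using h

/-- Integrate `(φ_k²)' = 2 φ_k φ_k' ≤ φ_k² + φ_k'²` from `-∞`. Writing `φ_k' = a - b` by the ladder
relation, `φ_k'² ≤ 2a² + 2b²`, and orthonormality gives the total `1 + k + (k + 1)`. Any polynomial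
bound would suffice. -/
theorem hermiteFun_sq_le (k : ℕ) (x : ℝ) : hermiteFun k x ^ 2 ≤ 2 * (k + 1) := by
  have hd (y : ℝ) : HasDerivAt (fun y => hermiteFun k y ^ 2)
      (2 * hermiteFun k y * deriv (hermiteFun k) y) y := by
    rw [(hasDerivAt_hermiteFun k y).deriv]
    refine ((hasDerivAt_hermiteFun k y).pow 2).congr_deriv ?_
    simp
  have hle (y : ℝ) : 2 * hermiteFun k y * deriv (hermiteFun k) y ≤
      hermiteFun k y * hermiteFun k y + (k * (hermiteFun (k - 1) y * hermiteFun (k - 1) y) +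
        (k + 1) * (hermiteFun (k + 1) y * hermiteFun (k + 1) y)) := by
    rw [(hasDerivAt_hermiteFun k y).deriv]
    have e1 : Real.sqrt ((k : ℝ) / 2) ^ 2 = k / 2 := Real.sq_sqrt (by positivity)
    have e2 : Real.sqrt (((k : ℝ) + 1) / 2) ^ 2 = (k + 1) / 2 := Real.sq_sqrt (by positivity)
    set a := Real.sqrt ((k : ℝ) / 2) * hermiteFun (k - 1) y with ha
    set b := Real.sqrt (((k : ℝ) + 1) / 2) * hermiteFun (k + 1) y with hb
    have ha2 : (k : ℝ) * (hermiteFun (k - 1) y * hermiteFun (k - 1) y) = 2 * a ^ 2 := by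
      rw [ha, mul_pow, e1]; ring
    have hb2 : ((k : ℝ) + 1) * (hermiteFun (k + 1) y * hermiteFun (k + 1) y) = 2 * b ^ 2 := by
      rw [hb, mul_pow, e2]; ring
    rw [ha2, hb2]
    nlinarith [sq_nonneg (hermiteFun k y - (a - b)), sq_nonneg (a + b)]
  have hi2 : Integrable (fun y => 2 * hermiteFun k y * deriv (hermiteFun k) y) := by
    have := ((SchwartzMap.pairing (ContinuousLinearMap.mul ℝ ℝ) (hermiteSchwartzReal k)
      (SchwartzMap.derivCLM ℝ ℝ (hermiteSchwartzReal k))).integrable (μ := volume)).const_mul 2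
    refine this.congr (Filter.Eventually.of_forall fun x => ?_)
    simp [SchwartzMap.pairing_apply_apply, coe_hermiteSchwartzReal, mul_assoc]
  have i0 := integrable_hermiteFun_mul k k
  have i1 := (integrable_hermiteFun_mul (k - 1) (k - 1)).const_mul (k : ℝ)
  have i2 := (integrable_hermiteFun_mul (k + 1) (k + 1)).const_mul ((k : ℝ) + 1)
  have hlim : Filter.Tendsto (fun y => hermiteFun k y ^ 2) Filter.atBot (nhds 0) := by
    have := (hermiteSchwartzReal k).tendsto_cocompact.mono_left atBot_le_cocompact
    rw [coe_hermiteSchwartzReal] at this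
    simpa using this.pow 2
  have hF := integral_Iic_of_hasDerivAt_of_tendsto' (fun y _ => hd y)
    hi2.integrableOn hlim (a := x)
  rw [sub_zero] at hF
  rw [← hF]
  calc _ ≤ ∫ y in Set.Iic x, (hermiteFun k y * hermiteFun k y +
        (k * (hermiteFun (k - 1) y * hermiteFun (k - 1) y) +
        (k + 1) * (hermiteFun (k + 1) y * hermiteFun (k + 1) y))) :=
        integral_mono hi2.integrableOn (i0.add (i1.add i2)).integrableOn hle
    _ ≤ ∫ y, (hermiteFun k y * hermiteFun k y +
        (k * (hermiteFun (k - 1) y * hermiteFun (k - 1) y) +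
        (k + 1) * (hermiteFun (k + 1) y * hermiteFun (k + 1) y))) := by
        refine setIntegral_le_integral (i0.add (i1.add i2))
          (Filter.Eventually.of_forall fun y => ?_)
        have a0 := mul_self_nonneg (hermiteFun k y)
        have a1 := mul_self_nonneg (hermiteFun (k - 1) y)
        have a2 := mul_self_nonneg (hermiteFun (k + 1) y)
        simp only [Pi.zero_apply]
        positivity
    _ = 2 * (k + 1) := by
        rw [integral_add i0 (by exact i1.add i2), integral_add i1 i2, integral_const_mul,
          integral_const_mul]
        simp only [integral_hermiteFun_mul, if_true]
        ring

theorem abs_hermiteFun_le (k : ℕ) (x : ℝ) : |hermiteFun k x| ≤ 2 * (k + 1) := by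
  have h := hermiteFun_sq_le k x
  refine abs_le_of_sq_le_sq ?_ (by positivity)
  nlinarith [(Nat.cast_nonneg k : (0 : ℝ) ≤ k)]

variable {d : ℕ}

/-! ### Coordinate multiplication and partial derivatives on Schwartz functions -/

theorem hasTemperateGrowth_coord (j : Fin d) :
    Function.HasTemperateGrowth (fun x : Rd d => (x j : ℂ)) :=
  (Complex.ofRealCLM ∘L (EuclideanSpace.proj j : Rd d →L[ℝ] ℝ)).hasTemperateGrowth

/-- Multiplication by the `j`-th coordinate. -/
def mulCoord (j : Fin d) : 𝓢(Rd d, ℂ) →L[ℂ] 𝓢(Rd d, ℂ) :=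
  SchwartzMap.smulLeftCLM ℂ (fun x : Rd d => (x j : ℂ))

theorem mulCoord_apply (j : Fin d) (g : 𝓢(Rd d, ℂ)) (x : Rd d) :
    mulCoord j g x = (x j : ℂ) * g x :=
  SchwartzMap.smulLeftCLM_apply_apply (hasTemperateGrowth_coord j) g x

/-- The `j`-th partial derivative. -/
def partialCLM (j : Fin d) : 𝓢(Rd d, ℂ) →L[ℂ] 𝓢(Rd d, ℂ) :=
  LineDeriv.lineDerivOpCLM ℂ 𝓢(Rd d, ℂ) (EuclideanSpace.single j (1 : ℝ) : Rd d)

theorem partialCLM_apply (j : Fin d) (g : 𝓢(Rd d, ℂ)) (x : Rd d) :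
    partialCLM j g x = fderiv ℝ g x (EuclideanSpace.single j 1) :=
  SchwartzMap.lineDerivOp_apply_eq_fderiv _ g x

theorem coe_partialCLM (j : Fin d) (g : 𝓢(Rd d, ℂ)) :
    (partialCLM j g : Rd d → ℂ) = partialDeriv j g :=
  funext (partialCLM_apply j g)

/-- The word of partial derivatives representing `∂^β`. -/
def derivWord (β : Fin d → ℕ) : List (𝓢(Rd d, ℂ) →L[ℂ] 𝓢(Rd d, ℂ)) :=
  (List.finRange d).flatMap fun j => List.replicate (β j) (partialCLM j)

theorem length_derivWord (β : Fin d → ℕ) : (derivWord β).length = len β := by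
  simp [derivWord, len, List.length_flatMap, Fin.sum_univ_def]

theorem coe_partialCLM_pow (j : Fin d) (n : ℕ) (g : 𝓢(Rd d, ℂ)) :
    ((partialCLM j ^ n) g : Rd d → ℂ) = (partialDeriv j)^[n] g := by
  induction n with
  | zero => rfl
  | succ n ih =>
    rw [pow_succ', Function.iterate_succ_apply', ← ih, ← coe_partialCLM]
    rfl

theorem multiDeriv_eq (β : Fin d → ℕ) (g : 𝓢(Rd d, ℂ)) :
    multiDeriv β g = ((derivWord β).prod g : 𝓢(Rd d, ℂ)) := by
  unfold multiDeriv derivWord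
  induction List.finRange d with
  | nil => rfl
  | cons j l ih =>
    rw [List.foldr_cons, ih, List.flatMap_cons, List.prod_append, List.prod_replicate,
      ← coe_partialCLM_pow]
    rfl

/-! ### Hermite functions on `ℝ^d` -/

theorem hermiteFunRd_eq_mul_prod (α : Fin d → ℕ) (j : Fin d) (x : Rd d) :
    hermiteFunRd α x =
      hermiteFun (α j) (x j) * ∏ i ∈ Finset.univ.erase j, hermiteFun (α i) (x i) :=
  (Finset.mul_prod_erase _ _ (Finset.mem_univ j)).symm

theorem hermiteFunRd_update (α : Fin d → ℕ) (j : Fin d) (n : ℕ) (x : Rd d) :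
    hermiteFunRd (Function.update α j n) x =
      hermiteFun n (x j) * ∏ i ∈ Finset.univ.erase j, hermiteFun (α i) (x i) := by
  rw [hermiteFunRd_eq_mul_prod _ j, Function.update_self]
  congr 1
  refine Finset.prod_congr rfl fun i hi => ?_
  rw [Function.update_of_ne (Finset.ne_of_mem_erase hi)]

theorem differentiable_hermiteFunRd (α : Fin d → ℕ) : Differentiable ℝ (hermiteFunRd α) := by
  unfold hermiteFunRd
  have h (k : ℕ) : Differentiable ℝ (hermiteFun k) :=
    fun x => (hasDerivAt_hermiteFun k x).differentiableAt
  have h2 (j : Fin d) : Differentiable ℝ (fun x : Rd d => hermiteFun (α j) (x j)) :=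
    (h _).comp (EuclideanSpace.proj j : Rd d →L[ℝ] ℝ).differentiable
  exact fun x => (HasFDerivAt.finsetProd (𝕜 := ℝ)
    (g := fun j (x : Rd d) => hermiteFun (α j) (x j)) (u := Finset.univ)
    fun i _ => (h2 i x).hasFDerivAt).differentiableAt

theorem fderiv_hermiteFunRd_single (α : Fin d → ℕ) (j : Fin d) (x : Rd d) (c : ℝ)
    (hc : HasDerivAt (hermiteFun (α j)) c (x j)) :
    fderiv ℝ (hermiteFunRd α) x (EuclideanSpace.single j 1) =
      c * ∏ i ∈ Finset.univ.erase j, hermiteFun (α i) (x i) := by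
  have h1 : HasLineDerivAt ℝ (hermiteFunRd α)
      (fderiv ℝ (hermiteFunRd α) x (EuclideanSpace.single j 1)) x (EuclideanSpace.single j 1) :=
    (differentiable_hermiteFunRd α x).hasFDerivAt.hasLineDerivAt _
  have h2 : HasDerivAt (fun t : ℝ => hermiteFun (α j) (x j + t) *
      ∏ i ∈ Finset.univ.erase j, hermiteFun (α i) (x i))
      (c * ∏ i ∈ Finset.univ.erase j, hermiteFun (α i) (x i)) 0 := by
    refine HasDerivAt.mul_const ?_ _
    have : HasDerivAt (hermiteFun (α j)) c (x j + 0) := by simpa using hc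
    exact this.comp_const_add (x j) 0
  refine HasDerivAt.unique h1 (h2.congr_of_eventuallyEq (Filter.Eventually.of_forall fun t => ?_))
  simp only
  rw [hermiteFunRd_eq_mul_prod _ j]
  congr 1
  · simp
  · refine Finset.prod_congr rfl fun i hi => ?_
    simp [Finset.ne_of_mem_erase hi]

theorem fderiv_ofReal_comp {f : Rd d → ℝ} (x v : Rd d) (hf : DifferentiableAt ℝ f x) :
    fderiv ℝ (fun x => (f x : ℂ)) x v = (fderiv ℝ f x v : ℂ) := by
  have h := (Complex.ofRealCLM.hasFDerivAt (x := f x)).comp x hf.hasFDerivAt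
  have h2 : fderiv ℝ (fun x => (f x : ℂ)) x = Complex.ofRealCLM.comp (fderiv ℝ f x) := h.fderiv
  rw [h2]
  rfl

/-- The additive form avoids truncated subtraction when an index is lowered. -/
theorem len_update_add (α : Fin d → ℕ) (j : Fin d) (n : ℕ) :
    len (Function.update α j n) + α j = len α + n := by
  unfold len
  rw [Finset.sum_update_of_mem (Finset.mem_univ j),
    ← Finset.add_sum_erase _ α (Finset.mem_univ j), Finset.sdiff_singleton_eq_erase]
  ring

theorem hermiteFunRd_zero (x : Rd d) : hermiteFunRd (0 : Fin d → ℕ) x =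
    (Real.sqrt (Real.sqrt Real.pi))⁻¹ ^ d * Real.exp (-(‖x‖ ^ 2 / 2)) := by
  simp only [hermiteFunRd, Pi.zero_apply, hermiteFun_zero, Finset.prod_mul_distrib,
    Finset.prod_const, Finset.card_univ, Fintype.card_fin, ← Real.exp_sum,
    EuclideanSpace.norm_sq_eq, Real.norm_eq_abs, sq_abs, neg_div, Finset.sum_neg_distrib,
    Finset.sum_div]

/-- Induction on `|α|`: a nonzero entry is produced by the creation operator in its coordinate,
starting from the Gaussian `Φ_0`. -/
theorem exists_schwartz_eq_hermiteFunRd (α : Fin d → ℕ) :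
    ∃ u : 𝓢(Rd d, ℂ), ∀ x, u x = (hermiteFunRd α x : ℂ) := by
  induction hn : len α generalizing α with
  | zero =>
    obtain rfl : α = 0 := by
      simp only [len, Finset.sum_eq_zero_iff] at hn
      exact funext fun j => hn j (Finset.mem_univ j)
    refine ⟨(((Real.sqrt (Real.sqrt Real.pi))⁻¹ ^ d : ℝ) : ℂ) •
      SchwartzMap.postcompCLM Complex.ofRealCLM (gaussianSchwartz (Rd d)), fun x => ?_⟩
    rw [smul_apply, SchwartzMap.postcompCLM_apply, gaussianSchwartz_apply, hermiteFunRd_zero]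
    simp
  | succ n ih =>
    obtain ⟨j, hj⟩ : ∃ j, α j ≠ 0 := by
      by_contra! h
      simp [len, h] at hn
    obtain ⟨m, hm⟩ := Nat.exists_eq_succ_of_ne_zero hj
    set α' := Function.update α j m with hα'
    have hl : len α' = n := by
      have := len_update_add α j m
      rw [← hα'] at this
      omega
    have hα'j : α' j = m := by rw [hα', Function.update_self]
    have hα : α = Function.update α' j (m + 1) := by
      rw [hα', Function.update_idem, ← Nat.succ_eq_add_one, ← hm, Function.update_eq_self]
    obtain ⟨u, hu⟩ := ih α' hl
    have hu' : (u : Rd d → ℂ) = fun x => (hermiteFunRd α' x : ℂ) := funext hu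
    refine ⟨(((Real.sqrt (2 * (m + 1)))⁻¹ : ℝ) : ℂ) • (mulCoord j u - partialCLM j u),
      fun x => ?_⟩
    have h0 : Real.sqrt (2 * ((m : ℝ) + 1)) ≠ 0 := by positivity
    have hd := hasDerivAt_hermiteFun_creation (α' j) (x j)
    rw [smul_apply, sub_apply, mulCoord_apply, partialCLM_apply, hu',
      fderiv_ofReal_comp _ _ (differentiable_hermiteFunRd α' x),
      fderiv_hermiteFunRd_single α' j x _ hd, hα'j]
    beta_reduce
    rw [hermiteFunRd_eq_mul_prod α' j, hα'j]
    conv_rhs => rw [hα, hermiteFunRd_update]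
    rw [smul_eq_mul]
    norm_cast
    field_simp
    ring

/-- The Hermite function `Φ_α` as a Schwartz function. -/
def hermiteS (α : Fin d → ℕ) : 𝓢(Rd d, ℂ) := (exists_schwartz_eq_hermiteFunRd α).choose

theorem hermiteS_apply (α : Fin d → ℕ) (x : Rd d) : hermiteS α x = (hermiteFunRd α x : ℂ) :=
  (exists_schwartz_eq_hermiteFunRd α).choose_spec x

theorem mulCoord_hermiteS (j : Fin d) (α : Fin d → ℕ) :
    mulCoord j (hermiteS α) =
      ((Real.sqrt (α j / 2) : ℝ) : ℂ) • hermiteS (Function.update α j (α j - 1)) +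
      ((Real.sqrt ((α j + 1) / 2) : ℝ) : ℂ) • hermiteS (Function.update α j (α j + 1)) := by
  ext x
  rw [mulCoord_apply, add_apply, smul_apply, smul_apply, hermiteS_apply, hermiteS_apply,
    hermiteS_apply, hermiteFunRd_update, hermiteFunRd_update, hermiteFunRd_eq_mul_prod α j]
  have h := mul_hermiteFun (α j) (x j)
  simp only [smul_eq_mul]
  norm_cast
  rw [← mul_assoc, h]
  push_cast
  ring

theorem partialCLM_hermiteS (j : Fin d) (α : Fin d → ℕ) :
    partialCLM j (hermiteS α) =
      ((Real.sqrt (α j / 2) : ℝ) : ℂ) • hermiteS (Function.update α j (α j - 1)) +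
      ((-Real.sqrt ((α j + 1) / 2) : ℝ) : ℂ) • hermiteS (Function.update α j (α j + 1)) := by
  ext x
  rw [partialCLM_apply, show (hermiteS α : Rd d → ℂ) = _ from funext (hermiteS_apply α),
    fderiv_ofReal_comp _ _ (differentiable_hermiteFunRd α x),
    fderiv_hermiteFunRd_single α j x _ (hasDerivAt_hermiteFun (α j) (x j)), add_apply, smul_apply,
    smul_apply, hermiteS_apply, hermiteS_apply, hermiteFunRd_update, hermiteFunRd_update]
  simp only [smul_eq_mul]
  norm_cast
  ring

/-! ### Ladder operators -/

/-- An operator which maps every Hermite function `Φ_α` to a combination of two Hermite functions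
of length at most `|α| + 1`, with coefficients bounded by `√((|α| + 1) / 2)`. -/
def IsLadder (T : 𝓢(Rd d, ℂ) →L[ℂ] 𝓢(Rd d, ℂ)) : Prop :=
  ∀ α, ∃ (a b : ℂ) (β γ : Fin d → ℕ), T (hermiteS α) = a • hermiteS β + b • hermiteS γ ∧
    ‖a‖ ≤ Real.sqrt ((len α + 1) / 2) ∧ ‖b‖ ≤ Real.sqrt ((len α + 1) / 2) ∧
    len β ≤ len α + 1 ∧ len γ ≤ len α + 1

theorem le_len (α : Fin d → ℕ) (j : Fin d) : α j ≤ len α :=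
  Finset.single_le_sum (f := α) (fun _ _ => Nat.zero_le _) (Finset.mem_univ j)

theorem isLadder_mulCoord (j : Fin d) : IsLadder (mulCoord j) := by
  intro α
  have hj : (α j : ℝ) ≤ len α := by exact_mod_cast le_len α j
  have h1 := len_update_add α j (α j - 1)
  have h2 := len_update_add α j (α j + 1)
  refine ⟨_, _, _, _, mulCoord_hermiteS j α, ?_, ?_, by omega, by omega⟩
  · rw [Complex.norm_real, Real.norm_of_nonneg (Real.sqrt_nonneg _)]
    exact Real.sqrt_le_sqrt (by linarith)
  · rw [Complex.norm_real, Real.norm_of_nonneg (Real.sqrt_nonneg _)]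
    exact Real.sqrt_le_sqrt (by linarith)

theorem isLadder_partialCLM (j : Fin d) : IsLadder (partialCLM j) := by
  intro α
  have hj : (α j : ℝ) ≤ len α := by exact_mod_cast le_len α j
  have h1 := len_update_add α j (α j - 1)
  have h2 := len_update_add α j (α j + 1)
  refine ⟨_, _, _, _, partialCLM_hermiteS j α, ?_, ?_, by omega, by omega⟩
  · rw [Complex.norm_real, Real.norm_of_nonneg (Real.sqrt_nonneg _)]
    exact Real.sqrt_le_sqrt (by linarith)
  · rw [Complex.norm_real, norm_neg, Real.norm_of_nonneg (Real.sqrt_nonneg _)]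
    exact Real.sqrt_le_sqrt (by linarith)

theorem IsLadder.seminorm_le {T : 𝓢(Rd d, ℂ) →L[ℂ] 𝓢(Rd d, ℂ)} (hT : IsLadder T)
    (q : Seminorm ℂ 𝓢(Rd d, ℂ)) {B : ℕ → ℝ} (hB : Monotone B)
    (hq : ∀ α, q (hermiteS α) ≤ B (len α)) (α : Fin d → ℕ) :
    q (T (hermiteS α)) ≤ Real.sqrt 2 * Real.sqrt (len α + 1) * B (len α + 1) := by
  obtain ⟨a, b, β, γ, h, ha, hb, hβ, hγ⟩ := hT α
  have h1 : q (hermiteS β) ≤ B (len α + 1) := (hq β).trans (hB hβ)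
  have h2 : q (hermiteS γ) ≤ B (len α + 1) := (hq γ).trans (hB hγ)
  rw [h]
  calc q (a • hermiteS β + b • hermiteS γ) ≤ ‖a‖ * q (hermiteS β) + ‖b‖ * q (hermiteS γ) := by
        simpa only [map_smul_eq_mul] using map_add_le_add q (a • hermiteS β) (b • hermiteS γ)
    _ ≤ Real.sqrt ((len α + 1) / 2) * B (len α + 1) +
        Real.sqrt ((len α + 1) / 2) * B (len α + 1) := by
        gcongr
    _ = Real.sqrt 2 * Real.sqrt (len α + 1) * B (len α + 1) := by
        have h2 : Real.sqrt 2 * Real.sqrt 2 = 2 := Real.mul_self_sqrt (by norm_num)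
        rw [Real.sqrt_div (by positivity)]
        have h0 : Real.sqrt 2 ≠ 0 := by positivity
        field_simp
        linear_combination (-B (len α + 1)) * h2

/-- Bound of a seminorm of a word of ladder operators applied to a Hermite function. -/
theorem seminorm_ladder_word_le (l : List (𝓢(Rd d, ℂ) →L[ℂ] 𝓢(Rd d, ℂ)))
    (hl : ∀ T ∈ l, IsLadder T) (q : Seminorm ℂ 𝓢(Rd d, ℂ)) {B : ℕ → ℝ} (hB : Monotone B)
    (hB0 : ∀ n, 0 ≤ B n) (hq : ∀ α, q (hermiteS α) ≤ B (len α)) (α : Fin d → ℕ) :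
    q (l.prod (hermiteS α)) ≤ Real.sqrt 2 ^ l.length *
      Real.sqrt (len α + l.length) ^ l.length * B (len α + l.length) := by
  induction l generalizing q B with
  | nil => simpa using hq α
  | cons T l ih =>
    -- The outermost operator `T` is absorbed into the seminorm, which is why `q` and `B` are
    -- generalized: `q ∘ T` satisfies the hypothesis with the bound of `IsLadder.seminorm_le`.
    have h := ih (fun S hS => hl S (List.mem_cons_of_mem _ hS)) (q.comp T.toLinearMap)
      (B := fun n => Real.sqrt 2 * Real.sqrt (n + 1) * B (n + 1))
      (fun m n hmn => by
        have := hB (Nat.add_le_add_right hmn 1)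
        have := hB0 (m + 1)
        dsimp only
        gcongr)
      (fun n => by have := hB0 (n + 1); positivity)
      (fun α => (hl T List.mem_cons_self).seminorm_le q hB hq α)
    have hn : ((len α + l.length : ℕ) : ℝ) + 1 = len α + (l.length + 1 : ℕ) := by
      push_cast; ring
    rw [List.prod_cons, List.length_cons]
    refine h.trans ?_
    rw [hn]
    have h0 := hB0 (len α + (l.length + 1))
    calc Real.sqrt 2 ^ l.length * Real.sqrt (len α + l.length) ^ l.length *
          (Real.sqrt 2 * Real.sqrt (len α + (l.length + 1 : ℕ)) * B (len α + (l.length + 1)))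
        ≤ Real.sqrt 2 ^ l.length * Real.sqrt (len α + (l.length + 1 : ℕ)) ^ l.length *
          (Real.sqrt 2 * Real.sqrt (len α + (l.length + 1 : ℕ)) * B (len α + (l.length + 1))) := by
          gcongr
          omega
      _ = _ := by ring

/-! ### Polynomial growth of the Schwartz seminorms of Hermite functions -/

/-- The seminorm `q` grows at most polynomially along the Hermite functions. -/
def PolyGrowth (q : Seminorm ℂ 𝓢(Rd d, ℂ)) : Prop :=
  ∃ (C : ℝ) (m : ℕ), 0 ≤ C ∧ ∀ α, q (hermiteS α) ≤ C * ((len α : ℝ) + 1) ^ m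

/-- One operator raises the degree by one, through `√2 √(n+1) ≤ 2(n+1)` and `n + 2 ≤ 2(n+1)`. Hence
the seminorms of all orders follow from the sup norm. -/
theorem PolyGrowth.comp_ladder {q : Seminorm ℂ 𝓢(Rd d, ℂ)} (hq : PolyGrowth q)
    {T : 𝓢(Rd d, ℂ) →L[ℂ] 𝓢(Rd d, ℂ)} (hT : IsLadder T) : PolyGrowth (q.comp T.toLinearMap) := by
  obtain ⟨C, m, hC, h⟩ := hq
  refine ⟨2 * C * 2 ^ m, m + 1, by positivity, fun α => ?_⟩
  have hm := hT.seminorm_le q (B := fun n => C * ((n : ℝ) + 1) ^ m)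
    (fun a b hab => by dsimp only; gcongr) h α
  refine hm.trans ?_
  have h2 : Real.sqrt 2 ≤ 2 := by
    rw [Real.sqrt_le_left (by norm_num)]; norm_num
  have h3 : Real.sqrt ((len α : ℝ) + 1) ≤ len α + 1 := by
    rw [Real.sqrt_le_left (by positivity)]
    nlinarith [(Nat.cast_nonneg (len α) : (0 : ℝ) ≤ len α)]
  have h4 : ((len α + 1 : ℕ) : ℝ) + 1 ≤ 2 * (len α + 1) := by
    push_cast; linarith [(Nat.cast_nonneg (len α) : (0 : ℝ) ≤ len α)]
  calc Real.sqrt 2 * Real.sqrt ((len α : ℝ) + 1) * (C * (((len α + 1 : ℕ) : ℝ) + 1) ^ m)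
      ≤ 2 * ((len α : ℝ) + 1) * (C * (2 * ((len α : ℝ) + 1)) ^ m) := by gcongr
    _ = _ := by rw [mul_pow]; ring

theorem PolyGrowth.of_le_sum {ι : Type*} [Fintype ι] {q : Seminorm ℂ 𝓢(Rd d, ℂ)}
    {Q : ι → Seminorm ℂ 𝓢(Rd d, ℂ)} (hQ : ∀ i, PolyGrowth (Q i))
    (h : ∀ g, q g ≤ ∑ i, Q i g) : PolyGrowth q := by
  choose C m hC hm using hQ
  refine ⟨∑ i, C i, ∑ i, m i, Finset.sum_nonneg fun i _ => hC i, fun α => (h _).trans ?_⟩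
  rw [Finset.sum_mul]
  refine Finset.sum_le_sum fun i _ => (hm i α).trans ?_
  have h1 : (1 : ℝ) ≤ len α + 1 := by linarith [(Nat.cast_nonneg (len α) : (0 : ℝ) ≤ len α)]
  exact mul_le_mul_of_nonneg_left (pow_le_pow_right₀ h1
    (Finset.single_le_sum (f := m) (fun _ _ => Nat.zero_le _) (Finset.mem_univ i))) (hC i)

theorem polyGrowth_seminorm_zero_zero :
    PolyGrowth (SchwartzMap.seminorm ℂ 0 0 : Seminorm ℂ 𝓢(Rd d, ℂ)) := by
  refine ⟨2 ^ d, d, by positivity, fun α => ?_⟩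
  refine SchwartzMap.seminorm_le_bound ℂ 0 0 _ (by positivity) fun x => ?_
  rw [pow_zero, one_mul, norm_iteratedFDeriv_zero, hermiteS_apply, Complex.norm_real, hermiteFunRd,
    norm_prod, ← mul_pow]
  calc ∏ j, ‖hermiteFun (α j) (x j)‖ ≤ ∏ _j : Fin d, (2 * ((len α : ℝ) + 1)) := by
        refine Finset.prod_le_prod (fun _ _ => norm_nonneg _) fun j _ => ?_
        refine (abs_hermiteFun_le _ _).trans ?_
        have : (α j : ℝ) ≤ len α := by exact_mod_cast le_len α j
        linarith
    _ = _ := by simp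

theorem sum_coord_smul_single (x : Rd d) :
    ∑ j, x j • (EuclideanSpace.single j (1 : ℝ) : Rd d) = x := by
  simpa using (EuclideanSpace.basisFun (Fin d) ℝ).sum_repr x

theorem norm_le_sum_coord (x : Rd d) : ‖x‖ ≤ ∑ j, |x j| := by
  conv_lhs => rw [← sum_coord_smul_single x]
  refine (norm_sum_le _ _).trans (Finset.sum_le_sum fun j _ => ?_)
  simp [norm_smul]

theorem polyGrowth_seminorm_zero (k : ℕ) :
    PolyGrowth (SchwartzMap.seminorm ℂ k 0 : Seminorm ℂ 𝓢(Rd d, ℂ)) := by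
  induction k with
  | zero => exact polyGrowth_seminorm_zero_zero
  | succ k ih =>
    refine PolyGrowth.of_le_sum (fun j => ih.comp_ladder (isLadder_mulCoord j)) fun g => ?_
    refine SchwartzMap.seminorm_le_bound ℂ _ _ _
      (Finset.sum_nonneg fun j _ => apply_nonneg _ _) fun x => ?_
    rw [norm_iteratedFDeriv_zero]
    calc ‖x‖ ^ (k + 1) * ‖g x‖ ≤ ‖x‖ ^ k * (∑ j, |x j|) * ‖g x‖ := by
          rw [pow_succ]
          gcongr
          exact norm_le_sum_coord x
      _ = ∑ j, ‖x‖ ^ k * ‖mulCoord j g x‖ := by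
          rw [Finset.mul_sum, Finset.sum_mul]
          refine Finset.sum_congr rfl fun j _ => ?_
          rw [mulCoord_apply, norm_mul, Complex.norm_real, Real.norm_eq_abs, mul_assoc]
      _ ≤ _ := Finset.sum_le_sum fun j _ => by
          have := SchwartzMap.le_seminorm ℂ k 0 (mulCoord j g) x
          rwa [norm_iteratedFDeriv_zero] at this

/-- Since `Dg = ∑ dx_j ⊗ ∂_j g` and each `c ↦ dx_j ⊗ c` has norm at most one, an order of
differentiation is traded for ladder operators. -/
theorem norm_iteratedFDeriv_succ_le_sum (g : 𝓢(Rd d, ℂ)) (n : ℕ) (x : Rd d) :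
    ‖iteratedFDeriv ℝ (n + 1) g x‖ ≤ ∑ j, ‖iteratedFDeriv ℝ n (partialCLM j g) x‖ := by
  let L (j : Fin d) : ℂ →L[ℝ] Rd d →L[ℝ] ℂ :=
    ContinuousLinearMap.smulRightL ℝ (Rd d) ℂ (EuclideanSpace.proj j)
  have hL (j : Fin d) : ‖L j‖ ≤ 1 := by
    refine ContinuousLinearMap.opNorm_le_bound _ zero_le_one fun c => ?_
    refine ContinuousLinearMap.opNorm_le_bound _ (by positivity) fun y => ?_
    change ‖y j • c‖ ≤ 1 * ‖c‖ * ‖y‖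
    rw [norm_smul, one_mul, mul_comm]
    gcongr
    exact PiLp.norm_apply_le y j
  have hf : fderiv ℝ g = fun x => ∑ j, (L j ∘ partialCLM j g) x := by
    ext x y
    conv_lhs => rw [← sum_coord_smul_single y]
    simp [L, partialCLM_apply, map_sum]
  have hc (j : Fin d) : ContDiff ℝ n (L j ∘ partialCLM j g) :=
    (L j).contDiff.comp ((partialCLM j g).smooth n)
  rw [← norm_iteratedFDeriv_fderiv, hf]
  rw [iteratedFDeriv_fun_sum_apply (fun j _ => (hc j).contDiffAt)]
  refine (norm_sum_le _ _).trans (Finset.sum_le_sum fun j _ => ?_)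
  refine ((L j).norm_iteratedFDeriv_comp_left ((partialCLM j g).contDiffAt n) le_rfl).trans ?_
  exact mul_le_of_le_one_left (norm_nonneg _) (hL j)

theorem polyGrowth_seminorm (k n : ℕ) :
    PolyGrowth (SchwartzMap.seminorm ℂ k n : Seminorm ℂ 𝓢(Rd d, ℂ)) := by
  induction n with
  | zero => exact polyGrowth_seminorm_zero k
  | succ n ih =>
    refine PolyGrowth.of_le_sum (fun j => ih.comp_ladder (isLadder_partialCLM j)) fun g => ?_
    refine SchwartzMap.seminorm_le_bound ℂ _ _ _
      (Finset.sum_nonneg fun j _ => apply_nonneg _ _) fun x => ?_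
    calc ‖x‖ ^ k * ‖iteratedFDeriv ℝ (n + 1) g x‖
        ≤ ‖x‖ ^ k * ∑ j, ‖iteratedFDeriv ℝ n (partialCLM j g) x‖ := by
          gcongr
          exact norm_iteratedFDeriv_succ_le_sum g n x
      _ ≤ _ := by
          rw [Finset.mul_sum]
          exact Finset.sum_le_sum fun j _ => SchwartzMap.le_seminorm ℂ k n (partialCLM j g) x

/-! ### Summability in the Schwartz space -/

section Summation

variable {E : Type*} [NormedAddCommGroup E] [NormedSpace ℝ E] {ι : Type*}

/-- A series of Schwartz functions which converges absolutely for every Schwartz seminorm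
converges in the Schwartz space. -/
theorem exists_hasSum_schwartz (u : ι → 𝓢(E, ℂ))
    (hu : ∀ k n, Summable fun i => SchwartzMap.seminorm ℂ k n (u i)) :
    ∃ g : 𝓢(E, ℂ), HasSum u g := by
  have hsm (i : ι) : ContDiff ℝ (⊤ : ℕ∞) (u i) := (u i).smooth ⊤
  have hbd (n : ℕ) (i : ι) (x : E) (_ : (n : ℕ∞) ≤ ⊤) :
      ‖iteratedFDeriv ℝ n (u i) x‖ ≤ SchwartzMap.seminorm ℂ 0 n (u i) :=
    SchwartzMap.norm_iteratedFDeriv_le_seminorm ℂ (u i) n x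
  have hder (n : ℕ) (x : E) : iteratedFDeriv ℝ n (fun x => ∑' i, u i x) x =
      ∑' i, iteratedFDeriv ℝ n (u i) x :=
    iteratedFDeriv_tsum_apply hsm (fun n _ => hu 0 n) hbd le_top x
  have hsum (n : ℕ) (x : E) : Summable fun i => iteratedFDeriv ℝ n (u i) x :=
    Summable.of_norm_bounded (hu 0 n) fun i => hbd n i x le_top
  -- Used with all indices for the decay of the sum, and with complements of finite sets for the
  -- convergence.
  have htail (k n : ℕ) (x : E) (s : Set ι) :
      ‖x‖ ^ k * ‖∑' i : s, iteratedFDeriv ℝ n (u i) x‖ ≤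
        ∑' i : s, SchwartzMap.seminorm ℂ k n (u i) := by
    have h1 : Summable fun i : s => ‖iteratedFDeriv ℝ n (u i) x‖ :=
      Summable.of_nonneg_of_le (fun _ => norm_nonneg _) (fun i => hbd n i x le_top)
        ((hu 0 n).subtype s)
    calc ‖x‖ ^ k * ‖∑' i : s, iteratedFDeriv ℝ n (u i) x‖
        ≤ ‖x‖ ^ k * ∑' i : s, ‖iteratedFDeriv ℝ n (u i) x‖ := by
          gcongr
          exact norm_tsum_le_tsum_norm h1
      _ = ∑' i : s, ‖x‖ ^ k * ‖iteratedFDeriv ℝ n (u i) x‖ := tsum_mul_left.symm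
      _ ≤ _ := (h1.mul_left _).tsum_le_tsum
          (fun i => SchwartzMap.le_seminorm ℂ k n (u i) x) ((hu k n).subtype s)
  let g : 𝓢(E, ℂ) :=
    { toFun := fun x => ∑' i, u i x
      smooth' := contDiff_tsum hsm (fun n _ => hu 0 n) hbd
      decay' := fun k n => ⟨∑' i, SchwartzMap.seminorm ℂ k n (u i), fun x => by
        rw [hder]
        have := htail k n x Set.univ
        rwa [tsum_univ (fun i => iteratedFDeriv ℝ n (u i) x),
          tsum_univ (fun i => SchwartzMap.seminorm ℂ k n (u i))] at this⟩ }
  refine ⟨g, ?_⟩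
  refine ((schwartz_withSeminorms ℂ E ℂ).tendsto_nhds _ _).2 ?_
  rintro ⟨k, n⟩ ε hε
  have ht := tendsto_tsum_compl_atTop_zero (fun i => SchwartzMap.seminorm ℂ k n (u i))
  refine (ht.eventually_lt_const hε).mono fun s hs => lt_of_le_of_lt ?_ hs
  refine SchwartzMap.seminorm_le_bound ℂ k n _ (tsum_nonneg fun i => apply_nonneg _ _) fun x => ?_
  have hfun : ((∑ i ∈ s, u i - g : 𝓢(E, ℂ)) : E → ℂ) =
      (fun x => ∑ i ∈ s, u i x) - fun x => ∑' i, u i x := by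
    ext x
    simp only [sub_apply, sum_apply, Pi.sub_apply]
    rfl
  have h1 : ContDiffAt ℝ n (fun x => ∑ i ∈ s, u i x) x :=
    ContDiffAt.sum fun i _ => (u i).contDiffAt n
  have h2 : ContDiffAt ℝ n (fun x => ∑' i, u i x) x := g.contDiffAt n
  rw [hfun, iteratedFDeriv_sub_apply h1 h2, hder,
    iteratedFDeriv_fun_sum_apply (fun i _ => (u i).contDiffAt n), norm_sub_rev]
  have h3 := (hsum n x).sum_add_tsum_subtype_compl s
  rw [← h3, add_sub_cancel_left]
  exact htail k n x {i | i ∉ s}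

end Summation

/-! ### Orthonormality and totality of the Hermite functions -/

theorem integral_hermiteFunRd_mul (α β : Fin d → ℕ) :
    ∫ x : Rd d, hermiteFunRd α x * hermiteFunRd β x = if α = β then 1 else 0 := by
  have h1 : ∫ x : Rd d, hermiteFunRd α x * hermiteFunRd β x =
      ∫ x : Fin d → ℝ, ∏ j, hermiteFun (α j) (x j) * hermiteFun (β j) (x j) := by
    rw [← (EuclideanSpace.volume_preserving_symm_measurableEquiv_toLp (Fin d)).integral_comp']
    simp only [hermiteFunRd, ← Finset.prod_mul_distrib]
    rfl
  rw [h1, integral_fintype_prod_volume_eq_prod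
    (fun j t => hermiteFun (α j) t * hermiteFun (β j) t)]
  simp only [integral_hermiteFun_mul]
  by_cases h : α = β
  · simp [h]
  · obtain ⟨j, hj⟩ := Function.ne_iff.1 h
    rw [if_neg h]
    exact Finset.prod_eq_zero (Finset.mem_univ j) (if_neg hj)

theorem integral_hermiteS_mul (α β : Fin d → ℕ) :
    ∫ x : Rd d, hermiteS α x * (hermiteFunRd β x : ℂ) = if α = β then 1 else 0 := by
  simp only [hermiteS_apply, ← Complex.ofReal_mul]
  rw [integral_complex_ofReal, integral_hermiteFunRd_mul]
  split_ifs <;> simp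

theorem norm_toLp_hermiteS (α : Fin d → ℕ) : ‖(hermiteS α).toLp 2 volume‖ = 1 := by
  have h := SchwartzMap.inner_toL2_toL2_eq (hermiteS α) (hermiteS α)
  have h2 (x : Rd d) : inner ℂ (hermiteS α x) (hermiteS α x) =
      hermiteS α x * (hermiteFunRd α x : ℂ) := by
    rw [RCLike.inner_apply, hermiteS_apply]
    simp
  simp_rw [h2] at h
  rw [integral_hermiteS_mul, if_pos rfl, inner_self_eq_norm_sq_to_K] at h
  have h3 : ‖(hermiteS α).toLp 2 volume‖ ^ 2 = 1 := by
    have h' := congrArg Complex.re h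
    norm_cast at h'
  exact (pow_eq_one_iff_of_nonneg (norm_nonneg _) two_ne_zero).1 h3

section Fourier

open scoped FourierTransform

variable {V : Type*} [NormedAddCommGroup V] [InnerProductSpace ℝ V] [FiniteDimensional ℝ V]
  [MeasurableSpace V] [BorelSpace V]

/-- An integrable function whose Fourier transform vanishes is zero. -/
theorem ae_eq_zero_of_fourier_eq_zero {u : V → ℂ} (hu : Integrable u) (h : ∀ w, 𝓕 u w = 0) :
    ∀ᵐ x, u x = 0 := by
  refine ae_eq_zero_of_integral_contDiff_smul_eq_zero hu.locallyIntegrable fun φ hφ hc => ?_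
  have hc' : HasCompactSupport (fun x => (φ x : ℂ)) := hc.comp_left (g := Complex.ofReal) rfl
  -- Every test function is the Fourier transform of a Schwartz function, so self-adjointness of `𝓕`
  -- moves the transform onto `u`, where it vanishes.
  let ψ : 𝓢(V, ℂ) := hc'.toSchwartzMap (Complex.ofRealCLM.contDiff.comp hφ)
  have hψ : 𝓕 ((𝓕⁻ ψ : 𝓢(V, ℂ)) : V → ℂ) = fun x => (φ x : ℂ) := by
    rw [← SchwartzMap.fourier_coe, FourierTransform.fourier_fourierInv_eq]
    rfl
  have hflip := VectorFourier.integral_fourierIntegral_smul_eq_flip (μ := (volume : Measure V))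
    (ν := (volume : Measure V)) (L := innerₗ V) (e := Real.fourierChar) (f := u)
    (g := ((𝓕⁻ ψ : 𝓢(V, ℂ)) : V → ℂ)) Real.continuous_fourierChar continuous_inner hu
    (SchwartzMap.integrable _)
  rw [flip_innerₗ] at hflip
  change ∫ ξ, 𝓕 u ξ • _ = ∫ x, u x • 𝓕 ((𝓕⁻ ψ : 𝓢(V, ℂ)) : V → ℂ) x at hflip
  rw [hψ] at hflip
  simp only [h, zero_smul, integral_zero] at hflip
  rw [hflip]
  refine integral_congr_ae (Filter.Eventually.of_forall fun x => ?_)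
  simp [mul_comm]

end Fourier

theorem hermiteFunRd_zero_pos (x : Rd d) : 0 < hermiteFunRd (0 : Fin d → ℕ) x := by
  rw [hermiteFunRd_zero]; positivity

/-- Multiplication by the linear form `⟨x, w⟩`. -/
def mulInner (w : Rd d) : 𝓢(Rd d, ℂ) →L[ℂ] 𝓢(Rd d, ℂ) := ∑ j, (w j : ℂ) • mulCoord j

theorem mulInner_apply (w : Rd d) (g : 𝓢(Rd d, ℂ)) (x : Rd d) :
    mulInner w g x = (inner ℝ x w : ℂ) * g x := by
  rw [mulInner, sum_apply, sum_apply]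
  simp only [smul_apply, mulCoord_apply, PiLp.inner_apply]
  push_cast
  rw [Finset.sum_mul]
  refine Finset.sum_congr rfl fun j _ => ?_
  simp
  ring

theorem mulInner_pow_apply (w : Rd d) (n : ℕ) (g : 𝓢(Rd d, ℂ)) (x : Rd d) :
    (mulInner w ^ n) g x = (inner ℝ x w : ℂ) ^ n * g x := by
  induction n with
  | zero => simp
  | succ n ih =>
    rw [pow_succ', mul_apply_eq_comp, mulInner_apply, ih]
    ring

/-- The ladder relation keeps the Hermite span stable under coordinate multiplication. Polynomials
times `Φ_0` are reached this way without explicit Hermite polynomials. -/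
theorem mulInner_pow_mem_span (w : Rd d) (n : ℕ) (α : Fin d → ℕ) :
    (mulInner w ^ n) (hermiteS α) ∈ Submodule.span ℂ (Set.range (hermiteS (d := d))) := by
  have hmem (β : Fin d → ℕ) : hermiteS β ∈ Submodule.span ℂ (Set.range (hermiteS (d := d))) :=
    Submodule.subset_span ⟨β, rfl⟩
  induction n with
  | zero => exact hmem α
  | succ n ih =>
    rw [pow_succ', mul_apply_eq_comp]
    refine Submodule.span_induction
      (p := fun g _ => mulInner w g ∈ Submodule.span ℂ (Set.range (hermiteS (d := d))))
      ?_ ?_ ?_ ?_ ih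
    · rintro _ ⟨β, rfl⟩
      rw [mulInner, sum_apply]
      refine Submodule.sum_mem _ fun j _ => ?_
      rw [smul_apply, mulCoord_hermiteS]
      exact Submodule.smul_mem _ _ (Submodule.add_mem _ (Submodule.smul_mem _ _ (hmem _))
        (Submodule.smul_mem _ _ (hmem _)))
    · simp
    · intro g g' _ _ hg hg'
      rw [map_add]
      exact Submodule.add_mem _ hg hg'
    · intro c g _ hg
      rw [map_smul]
      exact Submodule.smul_mem _ _ hg

theorem integrable_mul_schwartz {h : Rd d → ℂ} (hh : MemLp h 2 volume) (g : 𝓢(Rd d, ℂ)) :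
    Integrable fun x => h x * g x :=
  hh.integrable_mul (g.memLp 2 volume)

theorem integral_mul_eq_zero_of_mem_span {h : Rd d → ℂ} (hh : MemLp h 2 volume)
    (h0 : ∀ α : Fin d → ℕ, ∫ x, h x * (hermiteFunRd α x : ℂ) = 0) {g : 𝓢(Rd d, ℂ)}
    (hg : g ∈ Submodule.span ℂ (Set.range (hermiteS (d := d)))) : ∫ x, h x * g x = 0 := by
  refine Submodule.span_induction (p := fun g _ => ∫ x, h x * g x = 0) ?_ ?_ ?_ ?_ hg
  · rintro _ ⟨α, rfl⟩
    simpa only [hermiteS_apply] using h0 α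
  · simp
  · intro g g' _ _ hg hg'
    simp only [add_apply, mul_add]
    rw [integral_add (integrable_mul_schwartz hh g) (integrable_mul_schwartz hh g'), hg, hg',
      add_zero]
  · intro c g _ hg
    simp only [smul_apply, smul_eq_mul, mul_left_comm _ c]
    rw [integral_const_mul, hg, mul_zero]

/-- This dominates the exponential series of the Fourier kernel times `Φ_0`. Completing the square,
`c‖x‖ - ‖x‖²/2 ≤ c² - ‖x‖²/4`, leaves a Gaussian. -/
theorem memLp_exp_mul_hermiteFunRd_zero (w : Rd d) : MemLp (fun x : Rd d =>
    Real.exp (2 * Real.pi * |inner ℝ x w|) * hermiteFunRd (0 : Fin d → ℕ) x) 2 volume := by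
  set κ : ℝ := (Real.sqrt (Real.sqrt Real.pi))⁻¹ ^ d
  set c : ℝ := 2 * Real.pi * ‖w‖
  have hg : MemLp (fun x : Rd d => κ * Real.exp (c ^ 2) * Real.exp (-(‖x‖ ^ 2 / 4))) 2 volume := by
    refine MemLp.const_mul ?_ _
    rw [memLp_two_iff_integrable_sq (by fun_prop)]
    refine ((gaussianSchwartz (Rd d)).integrable (μ := volume)).congr
      (Filter.Eventually.of_forall fun x => ?_)
    simp only [gaussianSchwartz_apply]
    rw [← Real.exp_nat_mul]
    congr 1
    push_cast
    ring
  refine hg.mono' ?_ (Filter.Eventually.of_forall fun x => ?_)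
  · refine Continuous.aestronglyMeasurable (Continuous.mul ?_ ?_)
    · fun_prop
    · exact (differentiable_hermiteFunRd 0).continuous
  · have hκ : 0 ≤ κ := by positivity
    rw [hermiteFunRd_zero, Real.norm_of_nonneg (by positivity)]
    have h1 : 2 * Real.pi * |inner ℝ x w| ≤ c * ‖x‖ := by
      have := abs_real_inner_le_norm x w
      calc 2 * Real.pi * |inner ℝ x w| ≤ 2 * Real.pi * (‖x‖ * ‖w‖) := by gcongr
        _ = c * ‖x‖ := by ring
    have h2 : c * ‖x‖ - ‖x‖ ^ 2 / 2 ≤ c ^ 2 - ‖x‖ ^ 2 / 4 := by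
      nlinarith [sq_nonneg (c - ‖x‖ / 2), sq_nonneg c]
    calc Real.exp (2 * Real.pi * |inner ℝ x w|) * (κ * Real.exp (-(‖x‖ ^ 2 / 2)))
        = κ * Real.exp (2 * Real.pi * |inner ℝ x w| - ‖x‖ ^ 2 / 2) := by
          rw [sub_eq_add_neg, Real.exp_add]; ring
      _ ≤ κ * Real.exp (c ^ 2 - ‖x‖ ^ 2 / 4) := by
          exact mul_le_mul_of_nonneg_left (Real.exp_le_exp.2 (by linarith)) hκ
      _ = _ := by rw [sub_eq_add_neg, Real.exp_add]; ring

open scoped FourierTransform in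
/-- The Hermite functions are total in `L²(ℝ^d)`. -/
theorem ae_eq_zero_of_integral_hermiteFunRd_eq_zero {h : Rd d → ℂ} (hh : MemLp h 2 volume)
    (h0 : ∀ α : Fin d → ℕ, ∫ x, h x * (hermiteFunRd α x : ℂ) = 0) : ∀ᵐ x, h x = 0 := by
  have hI : Integrable fun x => h x * (hermiteFunRd (0 : Fin d → ℕ) x : ℂ) := by
    simpa only [hermiteS_apply] using integrable_mul_schwartz hh (hermiteS 0)
  have hF (w : Rd d) : 𝓕 (fun x => h x * (hermiteFunRd (0 : Fin d → ℕ) x : ℂ)) w = 0 := by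
    -- Expand the kernel `e^{-2πi⟨x,w⟩}` in its power series and integrate termwise: each term is a
    -- moment of `h Φ_0`, which vanishes because `⟨x,w⟩^n Φ_0` lies in the Hermite span.
    have hS := hasSum_integral_of_dominated_convergence (μ := (volume : Measure (Rd d)))
      (F := fun (n : ℕ) x => (-2 * Real.pi * Complex.I * (inner ℝ x w : ℂ)) ^ n / n.factorial *
        (h x * hermiteS 0 x))
      (f := fun x => Complex.exp (-2 * Real.pi * Complex.I * (inner ℝ x w : ℂ)) *
        (h x * hermiteS 0 x))
      (fun n x => (2 * Real.pi * |inner ℝ x w|) ^ n / n.factorial * ‖h x * hermiteS 0 x‖)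
      ?_ ?_ ?_ ?_ ?_
    · have hz (n : ℕ) : ∫ x, (-2 * Real.pi * Complex.I * (inner ℝ x w : ℂ)) ^ n / n.factorial *
          (h x * hermiteS 0 x) = 0 := by
        have := integral_mul_eq_zero_of_mem_span hh h0 (mulInner_pow_mem_span w n 0)
        simp only [mulInner_pow_apply] at this
        have h2 (x : Rd d) : (-2 * Real.pi * Complex.I * (inner ℝ x w : ℂ)) ^ n / n.factorial *
            (h x * hermiteS 0 x) = (-2 * Real.pi * Complex.I) ^ n / n.factorial *
              (h x * ((inner ℝ x w : ℂ) ^ n * hermiteS 0 x)) := by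
          rw [mul_pow]; ring
        simp_rw [h2]
        rw [integral_const_mul, this, mul_zero]
      simp only [hz] at hS
      have h3 := hS.unique hasSum_zero
      rw [Real.fourier_eq', ← h3]
      refine integral_congr_ae (Filter.Eventually.of_forall fun x => ?_)
      simp only [hermiteS_apply, smul_eq_mul]
      congr 2
      push_cast
      ring
    · intro n
      exact (Continuous.aestronglyMeasurable (by fun_prop)).mul
        (integrable_mul_schwartz hh _).aestronglyMeasurable
    · refine fun n => Filter.Eventually.of_forall fun x => le_of_eq ?_
      simp [abs_of_pos Real.pi_pos]
    · exact Filter.Eventually.of_forall fun x =>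
        (Real.summable_pow_div_factorial _).mul_right _
    · have h1 : Integrable fun x => ‖h x‖ *
          (Real.exp (2 * Real.pi * |inner ℝ x w|) * hermiteFunRd (0 : Fin d → ℕ) x) :=
        hh.norm.integrable_mul (memLp_exp_mul_hermiteFunRd_zero w)
      refine h1.congr (Filter.Eventually.of_forall fun x => ?_)
      simp only
      rw [tsum_mul_right, Real.exp_eq_exp_ℝ, NormedSpace.exp_eq_tsum_div, norm_mul, hermiteS_apply,
        Complex.norm_real, Real.norm_of_nonneg (hermiteFunRd_zero_pos x).le]
      ring
    · refine Filter.Eventually.of_forall fun x => HasSum.mul_right _ ?_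
      rw [Complex.exp_eq_exp_ℂ]
      exact NormedSpace.expSeries_div_hasSum_exp _
  filter_upwards [ae_eq_zero_of_fourier_eq_zero hI hF] with x hx
  have hp : ((hermiteFunRd (0 : Fin d → ℕ) x : ℝ) : ℂ) ≠ 0 := by
    exact_mod_cast (hermiteFunRd_zero_pos x).ne'
  exact (mul_eq_zero.1 hx).resolve_right hp

/-! ### A summable weight on multi-indices -/

theorem summable_prod_pi {a : ℕ → ℝ} (ha : ∀ n, 0 ≤ a n) (hs : Summable a) (d : ℕ) :
    Summable fun α : Fin d → ℕ => ∏ j, a (α j) := by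
  induction d with
  | zero => exact (hasSum_fintype _).summable
  | succ d ih =>
    have h := hs.mul_of_nonneg ih ha fun α => Finset.prod_nonneg fun j _ => ha (α j)
    rw [← (Fin.consEquiv fun _ : Fin (d + 1) => ℕ).summable_iff]
    refine h.congr fun α => ?_
    simp [Fin.prod_univ_succ, Fin.consEquiv]

/-- Each `1 + α_j` is at most `1 + |α|`, and `d (1 + 1/(d+1)) ≤ d + 1`; comparison with a product of
convergent one-dimensional series follows. -/
theorem summable_one_add_len (d : ℕ) :
    Summable fun α : Fin d → ℕ => (((1 : ℝ) + len α) ^ (d + 1))⁻¹ := by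
  have he : (1 : ℝ) < 1 + 1 / (d + 1) := by
    have : (0 : ℝ) < 1 / (d + 1) := by positivity
    linarith
  have hs : Summable fun n : ℕ => (((n + 1 : ℕ) : ℝ) ^ (1 + 1 / (d + 1) : ℝ))⁻¹ :=
    (summable_nat_add_iff 1).2 (Real.summable_nat_rpow_inv.2 he)
  refine Summable.of_nonneg_of_le (fun _ => by positivity) (fun α => ?_)
    (summable_prod_pi (fun n => by positivity) hs d)
  rw [Finset.prod_inv_distrib]
  have h1 : (1 : ℝ) ≤ 1 + len α := by linarith [(Nat.cast_nonneg (len α) : (0 : ℝ) ≤ len α)]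
  refine inv_anti₀ (Finset.prod_pos fun j _ => by positivity) ?_
  calc ∏ j, ((α j + 1 : ℕ) : ℝ) ^ (1 + 1 / (d + 1) : ℝ)
      ≤ ∏ _j : Fin d, (1 + len α : ℝ) ^ (1 + 1 / (d + 1) : ℝ) := by
        refine Finset.prod_le_prod (fun j _ => by positivity) fun j _ => ?_
        have : ((α j + 1 : ℕ) : ℝ) ≤ 1 + len α := by
          have := le_len α j
          rw [add_comm]
          exact_mod_cast Nat.add_le_add_left this 1
        gcongr
    _ = (1 + len α : ℝ) ^ ((1 + 1 / (d + 1) : ℝ) * d) := by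
        rw [Finset.prod_const, Finset.card_univ, Fintype.card_fin, Real.rpow_mul_natCast
          (by positivity)]
    _ ≤ (1 + len α : ℝ) ^ ((d + 1 : ℕ) : ℝ) := by
        refine Real.rpow_le_rpow_of_exponent_le h1 ?_
        have hd : (0 : ℝ) < (d : ℝ) + 1 := by positivity
        have h2 : 1 / ((d : ℝ) + 1) * d ≤ 1 := by
          rw [one_div_mul_eq_div, div_le_one hd]; linarith
        push_cast
        linarith
    _ = _ := Real.rpow_natCast _ _

/-! ### Hermite coefficients of functions in `GS_Θ` -/

section Coefficients

variable {Θ : ℝ≥0 → ℝ≥0}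

theorem hasSum_sq_of_mem_GS {f : Lp ℂ 2 (volume : Measure (Rd d))} (hf : f ∈ GS d Θ) :
    HasSum (fun α : Fin d → ℕ => (Real.exp (Θ (len α : ℝ≥0)) * ‖hermiteCoeff f α‖) ^ 2)
      ((gsNorm Θ f).toReal ^ 2) := by
  set a : (Fin d → ℕ) → ℝ := fun α => Real.exp (Θ (len α : ℝ≥0)) * ‖hermiteCoeff f α‖ with ha
  have ha0 (α : Fin d → ℕ) : 0 ≤ a α := by positivity
  have hS : ∑' α, ENNReal.ofReal (a α) ^ 2 ≠ ∞ := by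
    intro h
    have : gsNorm Θ f < ∞ := hf
    rw [gsNorm, h, ENNReal.top_rpow_of_pos (by norm_num)] at this
    exact lt_irrefl _ this
  have h2 : (gsNorm Θ f).toReal ^ 2 = (∑' α, ENNReal.ofReal (a α) ^ 2).toReal := by
    rw [gsNorm, ← ENNReal.toReal_rpow, ← Real.rpow_natCast, ← Real.rpow_mul ENNReal.toReal_nonneg]
    norm_num
    rfl
  have h3 (α : Fin d → ℕ) : (ENNReal.ofReal (a α) ^ 2).toReal = a α ^ 2 := by
    rw [ENNReal.toReal_pow, ENNReal.toReal_ofReal (ha0 α)]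
  have h4 := ENNReal.hasSum_toReal hS
  rw [h2, ENNReal.tsum_toReal_eq fun α => by finiteness]
  simpa only [h3] using h4

/-- Cauchy-Schwarz inequality for weighted sums of Hermite coefficients. -/
theorem sum_hermiteCoeff_le {f : Lp ℂ 2 (volume : Measure (Rd d))} (hf : f ∈ GS d Θ)
    {w : (Fin d → ℕ) → ℝ} (hw0 : ∀ α, 0 ≤ w α) {K : ℝ} (hK : 0 ≤ K)
    (hw : ∀ α, w α * Real.sqrt (1 + len α) ^ (d + 1) * Real.exp (-(Θ (len α : ℝ≥0) : ℝ)) ≤ K) :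
    Summable (fun α => ‖hermiteCoeff f α‖ * w α) ∧
      ∑' α, ‖hermiteCoeff f α‖ * w α ≤
        K * Real.sqrt (∑' α : Fin d → ℕ, (((1 : ℝ) + len α) ^ (d + 1))⁻¹) *
          (gsNorm Θ f).toReal := by
  set a : (Fin d → ℕ) → ℝ := fun α => Real.exp (Θ (len α : ℝ≥0)) * ‖hermiteCoeff f α‖ with ha
  set b : (Fin d → ℕ) → ℝ := fun α => (Real.sqrt (1 + len α) ^ (d + 1))⁻¹ with hb
  have hb2 (α : Fin d → ℕ) : b α ^ (2 : ℝ) = (((1 : ℝ) + len α) ^ (d + 1))⁻¹ := by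
    rw [Real.rpow_two, hb]
    simp only
    rw [inv_pow, ← pow_mul, mul_comm, pow_mul, Real.sq_sqrt (by positivity)]
  have ha2 (α : Fin d → ℕ) : a α ^ (2 : ℝ) = a α ^ 2 := Real.rpow_two _
  have hA : HasSum (fun α => a α ^ 2) ((gsNorm Θ f).toReal ^ 2) := hasSum_sq_of_mem_GS hf
  have hAs : Summable fun α => a α ^ (2 : ℝ) := by simpa only [ha2] using hA.summable
  have hBs : Summable fun α => b α ^ (2 : ℝ) := by
    simpa only [hb2] using summable_one_add_len d
  have h1 := Real.summable_mul_of_Lp_Lq_of_nonneg Real.HolderConjugate.two_two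
    (f := a) (g := b) (fun α => by positivity) (fun α => by positivity) hAs hBs
  have h2 := Real.inner_le_Lp_mul_Lq_tsum_of_nonneg Real.HolderConjugate.two_two
    (f := a) (g := b) (fun α => by positivity) (fun α => by positivity) hAs hBs
  simp only [ha2, hb2, hA.tsum_eq, ← Real.sqrt_eq_rpow] at h2
  rw [Real.sqrt_sq ENNReal.toReal_nonneg] at h2
  -- Split as `(e^Θ ‖c_α‖) (w_α e^{-Θ})`: the first factor is square summable with norm `gsNorm`,
  -- and the second is at most `K b α` with `b` square summable.
  have hle (α : Fin d → ℕ) : ‖hermiteCoeff f α‖ * w α ≤ K * (a α * b α) := by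
    have hv : 0 < Real.sqrt (1 + len α) ^ (d + 1) := by positivity
    have h3 : w α * Real.exp (-(Θ (len α : ℝ≥0) : ℝ)) ≤ K * b α := by
      rw [hb]
      simp only
      rw [← div_eq_mul_inv, le_div_iff₀ hv]
      linarith [hw α]
    have h4 : Real.exp (Θ (len α : ℝ≥0)) * Real.exp (-(Θ (len α : ℝ≥0) : ℝ)) = 1 := by
      rw [← Real.exp_add, add_neg_cancel, Real.exp_zero]
    calc ‖hermiteCoeff f α‖ * w α = a α * (w α * Real.exp (-(Θ (len α : ℝ≥0) : ℝ))) := by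
          rw [ha]
          linear_combination (-‖hermiteCoeff f α‖ * w α) * h4
      _ ≤ a α * (K * b α) := by gcongr
      _ = _ := by ring
  have hs : Summable fun α => ‖hermiteCoeff f α‖ * w α :=
    Summable.of_nonneg_of_le (fun α => mul_nonneg (norm_nonneg _) (hw0 α)) hle (h1.mul_left K)
  refine ⟨hs, (hs.tsum_le_tsum hle (h1.mul_left K)).trans ?_⟩
  rw [tsum_mul_left, mul_assoc]
  gcongr
  linarith

theorem pow_mul_exp_le_M (h1 : H1 Θ) (p : ℕ) (t : ℝ≥0) :
    (t : ℝ) ^ p * Real.exp (-(Θ t : ℝ)) ≤ (M Θ p).toReal := by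
  have h := le_iSup (fun t : ℝ≥0 => ENNReal.ofReal ((t : ℝ) ^ p * Real.exp (-(Θ t : ℝ)))) t
  exact (ENNReal.ofReal_le_iff_le_toReal (h1 p).2.ne).1 h

theorem add_pow_mul_exp_le (h1 : H1 Θ) (p : ℕ) (t : ℝ≥0) {a : ℝ} (ha : 0 ≤ a) :
    (a + t) ^ p * Real.exp (-(Θ t : ℝ)) ≤ 2 ^ p * (a ^ p + (M Θ p).toReal) := by
  have h := pow_mul_exp_le_M h1 p t
  have he : Real.exp (-(Θ t : ℝ)) ≤ 1 := Real.exp_le_one_iff.2 (by simp)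
  have h2 : (a + t) ^ p ≤ 2 ^ p * (a ^ p + (t : ℝ) ^ p) := by
    refine (add_pow_le ha t.coe_nonneg p).trans ?_
    exact mul_le_mul_of_nonneg_right (pow_le_pow_right₀ one_le_two (Nat.sub_le p 1))
      (by positivity)
  calc (a + t) ^ p * Real.exp (-(Θ t : ℝ))
      ≤ 2 ^ p * (a ^ p + (t : ℝ) ^ p) * Real.exp (-(Θ t : ℝ)) := by gcongr
    _ = 2 ^ p * (a ^ p * Real.exp (-(Θ t : ℝ)) + (t : ℝ) ^ p * Real.exp (-(Θ t : ℝ))) := by ring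
    _ ≤ 2 ^ p * (a ^ p * 1 + (M Θ p).toReal) := by gcongr
    _ = _ := by ring

/-- A continuous linear functional: integration against `Φ_β`. -/
def hermiteCoeffCLM (β : Fin d → ℕ) : 𝓢(Rd d, ℂ) →L[ℂ] ℂ :=
  SchwartzMap.integralCLM ℂ volume ∘L SchwartzMap.smulLeftCLM ℂ (hermiteS β)

theorem hermiteCoeffCLM_apply (β : Fin d → ℕ) (g : 𝓢(Rd d, ℂ)) :
    hermiteCoeffCLM β g = ∫ x, g x * (hermiteFunRd β x : ℂ) := by
  rw [hermiteCoeffCLM, ContinuousLinearMap.comp_apply, SchwartzMap.integralCLM_apply]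
  refine integral_congr_ae (Filter.Eventually.of_forall fun x => ?_)
  simp only
  rw [SchwartzMap.smulLeftCLM_apply_apply (hermiteS β).hasTemperateGrowth, hermiteS_apply,
    smul_eq_mul, mul_comm]

/-- A function in `GS_Θ` is the sum, in the Schwartz space, of its Hermite expansion. -/
theorem exists_hasSum_hermite (h1 : H1 Θ) {f : Lp ℂ 2 (volume : Measure (Rd d))}
    (hf : f ∈ GS d Θ) : ∃ g : 𝓢(Rd d, ℂ),
      HasSum (fun α => hermiteCoeff f α • hermiteS α) g ∧ (f : Rd d → ℂ) =ᵐ[volume] g := by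
  obtain ⟨g, hg⟩ := exists_hasSum_schwartz (fun α => hermiteCoeff f α • hermiteS α) (by
    intro k n
    obtain ⟨C, m, hC, hm⟩ := polyGrowth_seminorm (d := d) k n
    have hw := (sum_hermiteCoeff_le hf (w := fun α => C * ((len α : ℝ) + 1) ^ m)
      (fun α => by positivity)
      -- The bound of `add_pow_mul_exp_le` with `a = 1`: `m` powers come from the seminorm and at
      -- most `d + 1` from the Cauchy-Schwarz weight.
      (K := C * (2 ^ (m + (d + 1)) * (1 ^ (m + (d + 1)) + (M Θ (m + (d + 1))).toReal)))
      (by positivity) (fun α => by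
        have h := add_pow_mul_exp_le h1 (m + (d + 1)) (len α : ℝ≥0) zero_le_one
        have hs : Real.sqrt (1 + len α) ≤ 1 + len α := by
          rw [Real.sqrt_le_left (by positivity)]
          nlinarith [(Nat.cast_nonneg (len α) : (0 : ℝ) ≤ len α)]
        calc C * ((len α : ℝ) + 1) ^ m * Real.sqrt (1 + len α) ^ (d + 1) *
              Real.exp (-(Θ (len α : ℝ≥0) : ℝ))
            ≤ C * ((len α : ℝ) + 1) ^ m * (1 + len α) ^ (d + 1) *
              Real.exp (-(Θ (len α : ℝ≥0) : ℝ)) := by gcongr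
          _ = C * ((1 + ((len α : ℝ≥0) : ℝ)) ^ (m + (d + 1)) *
              Real.exp (-(Θ (len α : ℝ≥0) : ℝ))) := by
              rw [NNReal.coe_natCast, pow_add, add_comm (len α : ℝ)]; ring
          _ ≤ _ := by gcongr)).1
    refine Summable.of_nonneg_of_le (fun α => apply_nonneg _ _) (fun α => ?_) hw
    rw [map_smul_eq_mul]
    exact mul_le_mul_of_nonneg_left (hm α) (norm_nonneg _))
  refine ⟨g, hg, ?_⟩
  have hcoeff (β : Fin d → ℕ) : ∫ x, g x * (hermiteFunRd β x : ℂ) = hermiteCoeff f β := by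
    have h2 := hg.mapL (hermiteCoeffCLM β)
    have h3 (α : Fin d → ℕ) : hermiteCoeffCLM β (hermiteCoeff f α • hermiteS α) =
        if α = β then hermiteCoeff f β else 0 := by
      rw [map_smul, hermiteCoeffCLM_apply, integral_hermiteS_mul]
      by_cases h : α = β
      · simp [h]
      · simp [h]
    simp only [h3] at h2
    rw [← hermiteCoeffCLM_apply]
    exact h2.unique (hasSum_ite_eq β _)
  have hfm : MemLp f 2 volume := Lp.memLp f
  have hgm : MemLp g 2 volume := g.memLp 2 volume
  have h0 := ae_eq_zero_of_integral_hermiteFunRd_eq_zero (hfm.sub hgm) fun α => by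
    simp only [Pi.sub_apply, sub_mul]
    have hi1 := integrable_mul_schwartz hfm (hermiteS α)
    have hi2 := integrable_mul_schwartz hgm (hermiteS α)
    simp only [hermiteS_apply] at hi1 hi2
    rw [integral_sub hi1 hi2, hcoeff, hermiteCoeff, sub_self]
  filter_upwards [h0] with x hx
  exact sub_eq_zero.1 hx

end Coefficients

/-! ### Weighted `L²` estimates -/

/-- The `L²` norm as a seminorm on the Schwartz space. -/
def seminormL2 (d : ℕ) : Seminorm ℂ 𝓢(Rd d, ℂ) :=
  (normSeminorm ℂ (Lp ℂ 2 (volume : Measure (Rd d)))).comp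
    (SchwartzMap.toLpCLM ℂ ℂ 2 (volume : Measure (Rd d))).toLinearMap

theorem seminormL2_apply (g : 𝓢(Rd d, ℂ)) : seminormL2 d g = ‖g.toLp 2 volume‖ := rfl

theorem eLpNorm_eq_seminormL2 (g : 𝓢(Rd d, ℂ)) :
    eLpNorm g 2 volume = ENNReal.ofReal (seminormL2 d g) := by
  rw [seminormL2_apply, SchwartzMap.norm_toLp, ENNReal.ofReal_toReal (g.memLp 2 volume).2.ne]

/-- Only an upper bound `N` on the length enters, so that all weight words share one estimate. The
`1` in the base keeps it at least one, hence monotone in the exponent. -/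
theorem seminormL2_ladder_word_le (l : List (𝓢(Rd d, ℂ) →L[ℂ] 𝓢(Rd d, ℂ)))
    (hl : ∀ T ∈ l, IsLadder T) {N : ℕ} (hN : l.length ≤ N) (α : Fin d → ℕ) :
    seminormL2 d (l.prod (hermiteS α)) ≤
      Real.sqrt 2 ^ N * Real.sqrt (1 + N + len α) ^ N := by
  have h := seminorm_ladder_word_le l hl (seminormL2 d) (B := fun _ => 1) monotone_const
    (fun _ => zero_le_one) (fun α => (norm_toLp_hermiteS α).le) α
  rw [mul_one] at h
  have h2 : (1 : ℝ) ≤ Real.sqrt 2 := Real.one_le_sqrt.2 one_le_two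
  have hN' : (l.length : ℝ) ≤ N := by exact_mod_cast hN
  have h3 : (1 : ℝ) ≤ Real.sqrt (1 + N + len α) :=
    Real.one_le_sqrt.2 (by
      have : (0 : ℝ) ≤ N + len α := by positivity
      linarith)
  calc _ ≤ _ := h
    _ ≤ Real.sqrt 2 ^ l.length * Real.sqrt (1 + N + len α) ^ l.length := by
        gcongr ?_ * ?_ ^ _
        exact Real.sqrt_le_sqrt (by linarith)
    _ ≤ _ := by gcongr

/-- Words and the inclusion into `L²` are continuous on the Schwartz space, so they pass through the
series. -/
theorem seminormL2_ladder_word_le_tsum {c : (Fin d → ℕ) → ℂ} {g : 𝓢(Rd d, ℂ)}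
    (hg : HasSum (fun α => c α • hermiteS α) g)
    (l : List (𝓢(Rd d, ℂ) →L[ℂ] 𝓢(Rd d, ℂ))) (hl : ∀ T ∈ l, IsLadder T) {N : ℕ}
    (hN : l.length ≤ N)
    (hs : Summable fun α => ‖c α‖ * (Real.sqrt 2 ^ N * Real.sqrt (1 + N + len α) ^ N)) :
    seminormL2 d (l.prod g) ≤
      ∑' α, ‖c α‖ * (Real.sqrt 2 ^ N * Real.sqrt (1 + N + len α) ^ N) := by
  have h := hg.mapL (SchwartzMap.toLpCLM ℂ ℂ 2 (volume : Measure (Rd d)) ∘L l.prod)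
  rw [seminormL2_apply]
  change ‖(SchwartzMap.toLpCLM ℂ ℂ 2 (volume : Measure (Rd d)) ∘L l.prod) g‖ ≤ _
  rw [← h.tsum_eq]
  refine tsum_of_norm_bounded hs.hasSum fun α => ?_
  rw [map_smul, norm_smul]
  exact mul_le_mul_of_nonneg_left (seminormL2_ladder_word_le l hl hN α) (norm_nonneg _)

theorem sum_pow_le_card_pow_mul {ι : Type*} [Fintype ι] [Nonempty ι] {v : ι → ℝ}
    (hv : ∀ i, 0 ≤ v i) (k : ℕ) : (∑ i, v i) ^ k ≤ (Fintype.card ι : ℝ) ^ k * ∑ i, v i ^ k := by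
  obtain ⟨i, hi⟩ := Finite.exists_max v
  calc (∑ i, v i) ^ k ≤ (Fintype.card ι * v i) ^ k := by
        gcongr
        · exact Finset.sum_nonneg fun i _ => hv i
        · simpa using Finset.sum_le_card_nsmul Finset.univ v (v i) fun j _ => hi j
    _ = (Fintype.card ι : ℝ) ^ k * v i ^ k := mul_pow _ _ _
    _ ≤ _ := by
        gcongr
        exact Finset.single_le_sum (f := fun i => v i ^ k) (fun j _ => pow_nonneg (hv j) k)
          (Finset.mem_univ i)

/-- The words `1` and `x_j^k`, which together dominate the weight `⟨x⟩^k`. -/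
def weightWord (k : ℕ) : Option (Fin d) → List (𝓢(Rd d, ℂ) →L[ℂ] 𝓢(Rd d, ℂ))
  | none => []
  | some j => List.replicate k (mulCoord j)

theorem length_weightWord_le (k : ℕ) (o : Option (Fin d)) : (weightWord k o).length ≤ k := by
  cases o <;> simp [weightWord]

theorem mulCoord_pow_apply (j : Fin d) (k : ℕ) (g : 𝓢(Rd d, ℂ)) (x : Rd d) :
    (mulCoord j ^ k) g x = (x j : ℂ) ^ k * g x := by
  induction k with
  | zero => simp
  | succ k ih => rw [pow_succ', mul_apply_eq_comp, mulCoord_apply, ih]; ring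

/-- `⟨x⟩ ≤ 1 + ∑ |x_j|` has `d + 1` terms, each at most the largest. -/
theorem bracket_pow_mul_norm_le (k : ℕ) (g : 𝓢(Rd d, ℂ)) (x : Rd d) :
    bracket x ^ k * ‖g x‖ ≤ ((d : ℝ) + 1) ^ k * ∑ o, ‖(weightWord k o).prod g x‖ := by
  let v : Option (Fin d) → ℝ := fun o => o.elim 1 fun j => |x j|
  have hv (o : Option (Fin d)) : 0 ≤ v o := by
    cases o
    · exact zero_le_one
    · exact abs_nonneg _
  have hb : bracket x ≤ ∑ o, v o := by
    have h0 := norm_nonneg x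
    rw [Fintype.sum_option]
    calc bracket x ≤ 1 + ‖x‖ := by
          rw [bracket, Real.sqrt_le_left (by positivity)]
          nlinarith
      _ ≤ _ := by
          gcongr
          · exact le_rfl
          · exact norm_le_sum_coord x
  have hw (o : Option (Fin d)) : ‖(weightWord k o).prod g x‖ = v o ^ k * ‖g x‖ := by
    cases o with
    | none => simp [weightWord, v]
    | some j => rw [weightWord, List.prod_replicate, mulCoord_pow_apply]; simp [v]
  simp only [hw]
  rw [← Finset.sum_mul, ← mul_assoc]
  gcongr
  refine (pow_le_pow_left₀ (Real.sqrt_nonneg _) hb k).trans ?_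
  simpa using sum_pow_le_card_pow_mul hv k

theorem one_le_bracket (x : Rd d) : 1 ≤ bracket x :=
  Real.one_le_sqrt.2 (by linarith [sq_nonneg ‖x‖])

theorem eLpNorm_bracket_rpow_mul_le (g : 𝓢(Rd d, ℂ)) {r : ℝ} {k : ℕ} (hr : r ≤ k) {R : ℝ}
    (hR : ∀ o, seminormL2 d ((weightWord k o).prod g) ≤ R) :
    eLpNorm (fun x : Rd d => ((bracket x ^ r : ℝ) : ℂ) * g x) 2 volume ≤
      ENNReal.ofReal (((d : ℝ) + 1) ^ (k + 1) * R) := by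
  have hR0 : 0 ≤ R := (apply_nonneg _ _).trans (hR none)
  calc eLpNorm (fun x : Rd d => ((bracket x ^ r : ℝ) : ℂ) * g x) 2 volume
      ≤ eLpNorm (((d : ℝ) + 1) ^ k • ∑ o, fun x => ‖(weightWord k o).prod g x‖) 2 volume := by
        refine eLpNorm_mono_real fun x => ?_
        have hb := one_le_bracket x
        rw [norm_mul, Complex.norm_real, Real.norm_of_nonneg (by positivity)]
        simp only [Pi.smul_apply, Finset.sum_apply, smul_eq_mul]
        refine le_trans ?_ (bracket_pow_mul_norm_le k g x)
        gcongr
        rw [← Real.rpow_natCast]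
        exact Real.rpow_le_rpow_of_exponent_le hb hr
    _ ≤ ENNReal.ofReal (((d : ℝ) + 1) ^ k) * ∑ _o : Option (Fin d), ENNReal.ofReal R := by
        rw [eLpNorm_const_smul, Real.enorm_eq_ofReal (by positivity)]
        gcongr
        refine (eLpNorm_sum_le (fun o _ => ?_) one_le_two).trans (Finset.sum_le_sum fun o _ => ?_)
        · exact ((weightWord k o).prod g).continuous.norm.aestronglyMeasurable
        · rw [eLpNorm_norm, eLpNorm_eq_seminormL2]
          exact ENNReal.ofReal_le_ofReal (hR o)
    _ = _ := by
        rw [Finset.sum_const, Finset.card_univ, Fintype.card_option, Fintype.card_fin,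
          nsmul_eq_mul, ← ENNReal.ofReal_natCast, ← ENNReal.ofReal_mul (by positivity),
          ← ENNReal.ofReal_mul (by positivity)]
        congr 1
        push_cast
        ring

/-! ### The numerical estimate -/

section Numerics

variable {Θ : ℝ≥0 → ℝ≥0}

/-- The core estimate: all powers are collected into `(1 + N + t)^{sp}`, and `e^{-Θ} ≤ e^{-sΘ}` lets
the exponent `s` be factored out. -/
theorem weight_mul_exp_le (h1 : H1 Θ) {C L : ℝ≥0} (hL : 1 ≤ L)
    (h2 : ∀ p : ℕ, (p : ℝ≥0∞) ^ p ≤ C * (L : ℝ≥0∞) ^ p * M Θ p) {s : ℝ} (hs : 0 < s) (hs1 : s ≤ 1)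
    {N p : ℕ} (hd : 1 ≤ d) (hp : ((N : ℝ) + d + 1) / 2 ≤ s * p) (t : ℝ≥0) :
    Real.sqrt (1 + N + t) ^ N * Real.sqrt (1 + t) ^ (d + 1) * Real.exp (-(Θ t : ℝ)) ≤
      (4 * (L : ℝ)) ^ (s * p) * ((C : ℝ) + 1) ^ s * (M Θ p).toReal ^ s := by
  have ht := t.coe_nonneg
  have hN : (0 : ℝ) ≤ N := Nat.cast_nonneg N
  have hL' : (1 : ℝ) ≤ L := by exact_mod_cast hL
  have hM : 0 ≤ (M Θ p).toReal := ENNReal.toReal_nonneg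
  have hpp : (p : ℝ) ^ p ≤ C * (L : ℝ) ^ p * (M Θ p).toReal := by
    have h := ENNReal.toReal_mono (by have := (h1 p).2; finiteness) (h2 p)
    simpa using h
  -- This turns `(1 + N)^p` into `2^p p^p`, the quantity controlled by (H2).
  have hNp : 1 + (N : ℝ) ≤ 2 * p := by
    have hd' : (1 : ℝ) ≤ d := by exact_mod_cast hd
    have hsp : s * p ≤ p := mul_le_of_le_one_left (Nat.cast_nonneg p) hs1
    linarith
  have hbase : (1 + N + t) ^ p * Real.exp (-(Θ t : ℝ)) ≤
      (4 * (L : ℝ)) ^ p * ((C : ℝ) + 1) * (M Θ p).toReal := by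
    refine (add_pow_mul_exp_le h1 p t (by positivity)).trans ?_
    have hLp : (1 : ℝ) ≤ (2 * L) ^ p := one_le_pow₀ (by linarith)
    have h3 : (1 + (N : ℝ)) ^ p ≤ (2 * L) ^ p * C * (M Θ p).toReal := by
      calc (1 + (N : ℝ)) ^ p ≤ (2 * p) ^ p := by gcongr
        _ = 2 ^ p * (p : ℝ) ^ p := mul_pow _ _ _
        _ ≤ 2 ^ p * (C * (L : ℝ) ^ p * (M Θ p).toReal) := by gcongr
        _ = _ := by rw [mul_pow]; ring
    calc 2 ^ p * ((1 + (N : ℝ)) ^ p + (M Θ p).toReal)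
        ≤ 2 ^ p * ((2 * L) ^ p * C * (M Θ p).toReal + (2 * L) ^ p * (M Θ p).toReal) := by
          gcongr
          exact le_mul_of_one_le_left hM hLp
      _ = _ := by
          rw [show (4 : ℝ) * L = 2 * (2 * L) by ring, mul_pow 2 (2 * (L : ℝ))]; ring
  have hy : (1 : ℝ) ≤ 1 + N + t := by linarith
  have hsq (n : ℕ) : Real.sqrt (1 + N + t) ^ n = (1 + (N : ℝ) + t) ^ ((n : ℝ) / 2) := by
    rw [Real.sqrt_eq_rpow, ← Real.rpow_mul_natCast (by positivity)]
    congr 1; ring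
  calc Real.sqrt (1 + N + t) ^ N * Real.sqrt (1 + t) ^ (d + 1) * Real.exp (-(Θ t : ℝ))
      ≤ Real.sqrt (1 + N + t) ^ N * Real.sqrt (1 + N + t) ^ (d + 1) *
          Real.exp (-(Θ t : ℝ) * s) := by
        have h5 : Real.sqrt (1 + t) ≤ Real.sqrt (1 + N + t) := Real.sqrt_le_sqrt (by linarith)
        have h6 : -(Θ t : ℝ) ≤ -(Θ t : ℝ) * s := by
          nlinarith [(Θ t).coe_nonneg]
        gcongr
    _ ≤ (1 + (N : ℝ) + t) ^ (p * s) * Real.exp (-(Θ t : ℝ) * s) := by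
        rw [← pow_add, hsq]
        gcongr
        push_cast
        linarith
    _ = ((1 + N + t) ^ p * Real.exp (-(Θ t : ℝ))) ^ s := by
        rw [Real.mul_rpow (by positivity) (by positivity), Real.rpow_natCast_mul (by positivity),
          Real.exp_mul]
    _ ≤ ((4 * (L : ℝ)) ^ p * ((C : ℝ) + 1) * (M Θ p).toReal) ^ s := by gcongr
    _ = _ := by
        rw [Real.mul_rpow (by positivity) (by positivity), Real.mul_rpow (by positivity)
          (by positivity), ← Real.rpow_natCast_mul (by positivity), mul_comm (p : ℝ)]

/-- The constant `D` of the estimate. -/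
def boundConst (d : ℕ) (C L S : ℝ) : ℝ :=
  ((d : ℝ) + 1) ^ 2 * Real.sqrt 2 * max 1 (Real.sqrt S) * (4 * L) ^ (d + 3) * (C + 1)

theorem one_le_boundConst {C L S : ℝ} (hC : 0 ≤ C) (hL : 1 ≤ L) : 1 ≤ boundConst d C L S := by
  have h1 : (1 : ℝ) ≤ ((d : ℝ) + 1) ^ 2 := one_le_pow₀ (by simp)
  have h2 : (1 : ℝ) ≤ Real.sqrt 2 := Real.one_le_sqrt.2 one_le_two
  have h3 : (1 : ℝ) ≤ max 1 (Real.sqrt S) := le_max_left _ _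
  have h4 : (1 : ℝ) ≤ (4 * L) ^ (d + 3) := one_le_pow₀ (by linarith)
  exact one_le_mul_of_one_le_of_one_le (one_le_mul_of_one_le_of_one_le
    (one_le_mul_of_one_le_of_one_le (one_le_mul_of_one_le_of_one_le h1 h2) h3) h4) (by linarith)

/-- Each factor of `boundConst` raised to `E` absorbs one factor on the left; the square of `d + 1`
is there because `k + 1 ≤ 2E`. The constant can be independent of `s`, which enters only through `s
≤ 1` and the bound on `q = s p`. -/
theorem const_le_boundConst_rpow {C L S s E q : ℝ} {k N : ℕ} (hC : 0 ≤ C) (hL : 1 ≤ L)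
    (hs1 : s ≤ 1) (hE : 1 ≤ E) (hk : (k : ℝ) ≤ E) (hN : (N : ℝ) ≤ E) (hq : q ≤ E * (d + 3)) :
    ((d : ℝ) + 1) ^ (k + 1) * (Real.sqrt 2 ^ N * ((4 * L) ^ q * (C + 1) ^ s) * Real.sqrt S) ≤
      boundConst d C L S ^ E := by
  have h2 : (1 : ℝ) ≤ Real.sqrt 2 := Real.one_le_sqrt.2 one_le_two
  have h3 : (1 : ℝ) ≤ max 1 (Real.sqrt S) := le_max_left _ _
  have e1 : ((d : ℝ) + 1) ^ (k + 1) ≤ (((d : ℝ) + 1) ^ 2) ^ E := by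
    rw [← Real.rpow_natCast_mul (by positivity), ← Real.rpow_natCast]
    refine Real.rpow_le_rpow_of_exponent_le (by simp) ?_
    push_cast
    linarith
  have e2 : Real.sqrt 2 ^ N ≤ Real.sqrt 2 ^ E := by
    rw [← Real.rpow_natCast]
    exact Real.rpow_le_rpow_of_exponent_le h2 hN
  have e3 : Real.sqrt S ≤ max 1 (Real.sqrt S) ^ E :=
    (le_max_right _ _).trans (Real.self_le_rpow_of_one_le h3 hE)
  have e4 : (4 * L) ^ q ≤ ((4 * L) ^ (d + 3)) ^ E := by
    rw [← Real.rpow_natCast_mul (by positivity)]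
    refine Real.rpow_le_rpow_of_exponent_le (by linarith) ?_
    push_cast
    linarith
  have e5 : (C + 1) ^ s ≤ (C + 1) ^ E :=
    Real.rpow_le_rpow_of_exponent_le (by linarith) (hs1.trans hE)
  have hL0 : 0 ≤ L := by linarith
  have key {a b c e f : ℝ} (ha : 0 ≤ a) (hb : 0 ≤ b) (hc : 0 ≤ c) (he : 0 ≤ e) (hf : 0 ≤ f) :
      (a * b * c * e * f) ^ E = a ^ E * b ^ E * c ^ E * e ^ E * f ^ E := by
    rw [Real.mul_rpow (by positivity) hf, Real.mul_rpow (by positivity) he,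
      Real.mul_rpow (by positivity) hc, Real.mul_rpow ha hb]
  rw [boundConst, key (by positivity) (by positivity) (by positivity) (by positivity)
    (by positivity)]
  calc _ ≤ (((d : ℝ) + 1) ^ 2) ^ E * (Real.sqrt 2 ^ E *
        (((4 * L) ^ (d + 3)) ^ E * (C + 1) ^ E) * max 1 (Real.sqrt S) ^ E) := by gcongr
    _ = _ := by ring

end Numerics

end GelfandShilov

end

/-! ### The inclusion in the Schwartz space and the weighted estimate -/

open GelfandShilov in
theorem proposition2p4 (d : ℕ) (hd : 1 ≤ d) (Θ : ℝ≥0 → ℝ≥0) (hΘ : Continuous Θ)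
    (h1 : H1 Θ) (h2 : H2 Θ) :
    (∀ f ∈ GS d Θ, ∃ g : 𝓢(Rd d, ℂ), (f : Rd d → ℂ) =ᵐ[volume] (g : Rd d → ℂ)) ∧
    ∀ s : ℝ, 0 < s → s ≤ 1 →
      ∃ D : ℝ≥0, 1 ≤ D ∧
        ∀ f ∈ GS d Θ, ∀ g : 𝓢(Rd d, ℂ), (f : Rd d → ℂ) =ᵐ[volume] (g : Rd d → ℂ) →
          ∀ r : ℝ, 0 ≤ r → ∀ β : Fin d → ℕ,
            eLpNorm (fun x : Rd d => ((bracket x ^ r : ℝ) : ℂ) * multiDeriv β g x) 2 volume ≤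
              (D : ℝ≥0∞) ^ (1 + r + (len β : ℝ)) *
                M Θ (⌊(r + 1 + (len β : ℝ) + (2 - s) * ((d : ℝ) + 1)) / (2 * s)⌋₊ + 1) ^ s *
                gsNorm Θ f := by
  refine ⟨fun f hf => (exists_hasSum_hermite h1 hf).imp fun g hg => hg.2, fun s hs hs1 => ?_⟩
  obtain ⟨C, L, -, hL, hCL⟩ := h2
  have hL' : (1 : ℝ) ≤ L := by exact_mod_cast hL
  set S : ℝ := ∑' α : Fin d → ℕ, (((1 : ℝ) + len α) ^ (d + 1))⁻¹ with hS
  have hD1 : 1 ≤ boundConst d C L S := one_le_boundConst C.coe_nonneg hL'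
  refine ⟨(boundConst d C L S).toNNReal, Real.one_le_toNNReal.2 hD1, fun f hf g hfg r hr β => ?_⟩
  obtain ⟨g', hg', hfg'⟩ := exists_hasSum_hermite h1 hf
  -- Continuous functions equal almost everywhere are equal, so the given representative is the sum
  -- of the Hermite series.
  obtain rfl : g = g' := DFunLike.coe_injective
    ((g.continuous.ae_eq_iff_eq volume g'.continuous).1 (hfg.symm.trans hfg'))
  set E : ℝ := 1 + r + len β with hE
  have hβ : (0 : ℝ) ≤ len β := Nat.cast_nonneg _
  have hd0 : (0 : ℝ) ≤ d := Nat.cast_nonneg _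
  set z : ℝ := (r + 1 + (len β : ℝ) + (2 - s) * ((d : ℝ) + 1)) / (2 * s) with hz
  set p : ℕ := ⌊z⌋₊ + 1 with hp
  have hz0 : 0 ≤ z := div_nonneg (by nlinarith) (by positivity)
  have hzs : s * z = (E + (2 - s) * ((d : ℝ) + 1)) / 2 := by
    rw [hz, hE]
    field_simp
    ring
  have hpz : z ≤ p := by
    rw [hp]; push_cast; exact (Nat.lt_floor_add_one z).le
  have hpz' : (p : ℝ) ≤ z + 1 := by
    rw [hp]; push_cast; linarith [Nat.floor_le hz0]
  -- Rounding `r` up to an integer power costs at most one, which the `1` in `E = 1 + r + |β|` pays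
  -- for.
  set k : ℕ := ⌈r⌉₊ with hk
  have hkr : (k : ℝ) ≤ r + 1 := (Nat.ceil_lt_add_one hr).le
  set N : ℕ := k + len β with hN
  have hNE : (N : ℝ) ≤ E := by rw [hN]; push_cast; linarith
  -- From `s z ≤ s p`, with `N ≤ E` and `2 - s ≥ 1` in the formula for `s z`.
  have hsp : ((N : ℝ) + d + 1) / 2 ≤ s * p := by
    have := mul_le_mul_of_nonneg_left hpz hs.le
    nlinarith
  -- Here `s p ≤ s z + s`; as `E ≥ 1`, the factor `d + 3` leaves ample room.
  have hsp' : s * p ≤ E * (d + 3) := by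
    have := mul_le_mul_of_nonneg_left hpz' hs.le
    nlinarith
  set K : ℝ := Real.sqrt 2 ^ N *
    ((4 * (L : ℝ)) ^ (s * p) * ((C : ℝ) + 1) ^ s * (M Θ p).toReal ^ s) with hK
  obtain ⟨hsum, hle⟩ := sum_hermiteCoeff_le hf
    (w := fun α => Real.sqrt 2 ^ N * Real.sqrt (1 + N + len α) ^ N) (fun α => by positivity)
    (K := K) (by positivity) (fun α => by
      have := weight_mul_exp_le h1 hL hCL hs hs1 hd hsp (len α : ℝ≥0)
      rw [NNReal.coe_natCast] at this
      rw [hK, mul_assoc, mul_assoc, ← mul_assoc (Real.sqrt (1 + N + len α) ^ N)]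
      gcongr)
  have hword (o : Option (Fin d)) :
      seminormL2 d ((weightWord k o).prod ((derivWord β).prod g)) ≤
        K * Real.sqrt S * (gsNorm Θ f).toReal := by
    have h := seminormL2_ladder_word_le_tsum hg' (weightWord k o ++ derivWord β) ?_ (N := N) ?_ hsum
    · rw [List.prod_append] at h
      exact h.trans hle
    · intro T hT
      rcases List.mem_append.1 hT with hT | hT
      · cases o with
        | none => simp [weightWord] at hT
        | some j =>
          rw [List.eq_of_mem_replicate hT]
          exact isLadder_mulCoord j
      · obtain ⟨j, -, hj⟩ := List.mem_flatMap.1 hT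
        rw [List.eq_of_mem_replicate hj]
        exact isLadder_partialCLM j
    · rw [List.length_append, length_derivWord]
      exact Nat.add_le_add_right (length_weightWord_le k o) _
  rw [multiDeriv_eq]
  refine (eLpNorm_bracket_rpow_mul_le _ (Nat.le_ceil r) hword).trans ?_
  have hGtop : gsNorm Θ f ≠ ∞ := ne_of_lt hf
  have hMtop : M Θ p ≠ ∞ := (h1 p).2.ne
  have hD0 : 0 ≤ boundConst d C L S := zero_le_one.trans hD1
  have hrhs : ((boundConst d C L S).toNNReal : ℝ≥0∞) ^ E * M Θ p ^ s *
      gsNorm Θ f = ENNReal.ofReal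
        (boundConst d C L S ^ E * (M Θ p).toReal ^ s * (gsNorm Θ f).toReal) := by
    rw [ENNReal.ofReal_mul (by positivity), ENNReal.ofReal_mul (by positivity),
      ENNReal.ofReal_toReal hGtop, ← ENNReal.ofReal_rpow_of_nonneg ENNReal.toReal_nonneg hs.le,
      ENNReal.ofReal_toReal hMtop, ← ENNReal.ofReal_rpow_of_nonneg hD0 (by linarith)]
    rfl
  rw [hrhs]
  refine ENNReal.ofReal_le_ofReal ?_
  have hc := const_le_boundConst_rpow (d := d) (S := S) (k := k) (N := N) C.coe_nonneg hL' hs1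
    (E := E) (q := s * p) (by linarith) (by linarith) hNE hsp'
  calc ((d : ℝ) + 1) ^ (k + 1) * (K * Real.sqrt S * (gsNorm Θ f).toReal)
      = ((d : ℝ) + 1) ^ (k + 1) * (Real.sqrt 2 ^ N * ((4 * (L : ℝ)) ^ (s * p) *
          ((C : ℝ) + 1) ^ s) * Real.sqrt S) * (M Θ p).toReal ^ s * (gsNorm Θ f).toReal := by
        rw [hK]; ring
    _ ≤ _ := by gcongr
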